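/- Let $\Gamma = N\rtimes G$ be the semidirect product of (discrete) groups for an action of $G$ on $N$ by automorphisms, written $n\mapsto gng^{-1}$, and let $\Gamma_0$ be a normal subgroup of $N$. Let $S$ be a subsemigroup of $G$ (not necessarily containing $1$) such that $S^{-1}S=G$, and such that $s^{-1}\Gamma_0 s\subset\Gamma_0$ with finite index for every $s\in S$. A pair of groups $H\subset K$ is a Hecke pair if every double coset $HkH$ is a finite union of left cosets of $H$. Its Hecke $*$-algebra $\mathcal H(K,H)$ consists of the $H$-biinvariant functions $K\to\mathbb C$ supported in finitely many double cosets, with $(f*g)(k)=\sum_{k_1\in H\backslash K}f(kk_1^{-1})g(k_1)$ and $f^*(k)=\overline{f(k^{-1})}$; $[k]$ denotes the characteristic function of $HkH$, and $R(k)$ the number of right cosets of $H$ in $HkH$. For a unital $*$-algebra $A$, the universal $C^*$-algebra of $A$ exists if $\sup_\pi\|\pi(a)\|<\infty$ for every $a\in A$, where $\pi$ runs through the unital $*$-representations of $A$ on Hilbert spaces; it is then the Hausdorff completion of $A$ in this seminorm. It is denoted $C^*_u(K,H)$ for $A=\mathcal H(K,H)$, and $C^*(Q)$ (the full group $C^*$-algebra)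 for the group algebra $A=\mathbb C(Q)$. If $\alpha$ is an action of $S$ on a unital $*$-algebra $A$ by (not necessarily unital) $*$-endomorphisms, the $*$-algebraic semigroup crossed product $A\rtimes_\alpha S$ is the universal unital $*$-algebra generated by a unital copy of $A$ and a representation $v$ of $S$ by isometries such that $v_s a v_s^*=\alpha_s(a)$ for $s\in S$, $a\in A$. If $A$ is a $C^*$-algebra, the $C^*$-algebraic semigroup crossed product, denoted in the same way, is the universal $C^*$-algebra of this $*$-algebra. Then $(N,\Gamma_0)$ and $(\Gamma,\Gamma_0)$ are Hecke pairs, and $[x]\mapsto x\Gamma_0$ $(x\in N)$ defines a $*$-isomorphism $\mathcal H(N,\Gamma_0)\cong\mathbb C(N/\Gamma_0)$. Writing $e(x)$ for the element $x\Gamma_0$ of $\mathbb C(N/\Gamma_0)$, there is an action $\alpha$ of $S$ on $\mathbb C(N/\Gamma_0)$ by $*$-endomorphisms such that $$\alpha_s(e(x))=\frac1{R(s)}\sum_{y\Gamma_0\in N/\Gamma_0,\ s^{-1}ys\,\Gamma_0=x\Gamma_0}e(y)\qquad(s\in S,\ x\in N),$$ and there is an isomorphism of $*$-algebras $$\mathcal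 H(\Gamma,\Gamma_0)\cong\mathbb C(N/\Gamma_0)\rtimes_\alpha S$$ that maps $[x]$ to $e(x)$ for $x\in N$, and $R(s)^{-1/2}[s]$ to $v_s$ for $s\in S$. Moreover the universal $C^*$-algebra $C^*_u(\Gamma,\Gamma_0)$ exists, $\alpha$ extends to an action of $S$ by $*$-endomorphisms of $C^*(N/\Gamma_0)$, again denoted $\alpha$, and there is an isomorphism of $C^*$-algebras $$C^*_u(\Gamma,\Gamma_0)\cong C^*(N/\Gamma_0)\rtimes_\alpha S$$ given by the same formulas on generators. -/

import Mathlib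

open scoped Pointwise ComplexConjugate

universe u v w

noncomputable section

/-! ### Hecke pairs and Hecke algebras -/

section Hecke

variable {Γ : Type u} [Group Γ]

/-- `(Γ, H)` is a Hecke pair: each double coset `HγH` is a finite union of left cosets `γ'H`. -/
def IsHeckePair (H : Subgroup Γ) : Prop :=
  ∀ γ : Γ, ((fun x : Γ => (x : Γ ⧸ H)) '' DoubleCoset.doubleCoset γ H H).Finite

/-- The set `H \ Γ` of right cosets `Hγ`. -/
abbrev RightCosets (H : Subgroup Γ) : Type u := Quotient (QuotientGroup.rightRel H)

/-- The right coset `Hγ`. -/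
def RightCosets.mk (H : Subgroup Γ) (γ : Γ) : RightCosets H :=
  Quotient.mk (QuotientGroup.rightRel H) γ

/-- `R(γ)`: the number of right cosets of `H` in the double coset `HγH`. -/
def heckeR (H : Subgroup Γ) (γ : Γ) : ℕ :=
  (RightCosets.mk H '' DoubleCoset.doubleCoset γ H H).ncard

/-- The space of `H`-biinvariant complex functions on `Γ` that are supported in finitely many
double cosets. -/
def heckeSubmodule (H : Subgroup Γ) : Submodule ℂ (Γ → ℂ) where
  carrier := {f | (∀ h ∈ H, ∀ x, f (h * x) = f x) ∧ (∀ h ∈ H, ∀ x, f (x * h) = f x) ∧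
    (DoubleCoset.mk H H '' Function.support f).Finite}
  zero_mem' := by simp
  add_mem' := by
    rintro f g ⟨hf1, hf2, hf3⟩ ⟨hg1, hg2, hg3⟩
    refine ⟨fun h hh x => by simp [hf1 h hh, hg1 h hh], fun h hh x => by simp [hf2 h hh, hg2 h hh],
      ((hf3.union hg3).subset ?_)⟩
    rw [← Set.image_union]
    exact Set.image_mono (Function.support_add f g)
  smul_mem' := by
    rintro c f ⟨hf1, hf2, hf3⟩
    refine ⟨fun h hh x => by simp [hf1 h hh], fun h hh x => by simp [hf2 h hh],
      (hf3.subset (Set.image_mono (Function.support_const_smul_subset c f)))⟩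

/-- The sum of `F` over a set of representatives of `H \ Γ`. -/
def cosetSum (H : Subgroup Γ) (F : Γ → ℂ) : ℂ := ∑ᶠ q : RightCosets H, F q.out

/-- The convolution product `(f * g)(γ) = ∑_{γ₁ ∈ H \ Γ} f(γ γ₁⁻¹) g(γ₁)`. -/
def heckeConv (H : Subgroup Γ) (f g : Γ → ℂ) (γ : Γ) : ℂ :=
  cosetSum H fun γ₁ => f (γ * γ₁⁻¹) * g γ₁

/-- The involution `f*(γ) = conj (f(γ⁻¹))`. -/
def heckeStar (f : Γ → ℂ) (γ : Γ) : ℂ := conj (f γ⁻¹)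

theorem RightCosets.mk_eq_iff (H : Subgroup Γ) {x y : Γ} :
    RightCosets.mk H x = RightCosets.mk H y ↔ y * x⁻¹ ∈ H := by
  rw [RightCosets.mk, RightCosets.mk, Quotient.eq, QuotientGroup.rightRel_apply]

theorem RightCosets.mk_out {H : Subgroup Γ} (q : RightCosets H) : RightCosets.mk H q.out = q :=
  Quotient.out_eq q

/-- Invariance of `F` under left multiplication by `H`. -/
def LeftInv (H : Subgroup Γ) (F : Γ → ℂ) : Prop := ∀ h ∈ H, ∀ x, F (h * x) = F x

theorem LeftInv.out {H : Subgroup Γ} {F : Γ → ℂ} (hF : LeftInv H F) {x y : Γ}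
    (h : RightCosets.mk H x = RightCosets.mk H y) : F x = F y := by
  rw [RightCosets.mk_eq_iff] at h
  simpa using (hF _ h x).symm

theorem LeftInv.out_mk {H : Subgroup Γ} {F : Γ → ℂ} (hF : LeftInv H F) (x : Γ) :
    F (RightCosets.mk H x).out = F x :=
  hF.out (RightCosets.mk_out _)

/-- Right translation by `y` on `H \ Γ`. -/
def RightCosets.translate (H : Subgroup Γ) (y : Γ) : RightCosets H ≃ RightCosets H where
  toFun q := RightCosets.mk H (q.out * y)
  invFun q := RightCosets.mk H (q.out * y⁻¹)
  left_inv q := by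
    conv_rhs => rw [← RightCosets.mk_out q]
    rw [RightCosets.mk_eq_iff]
    have := (RightCosets.mk_eq_iff H).1 (RightCosets.mk_out (RightCosets.mk H (q.out * y)))
    simpa [mul_assoc] using this
  right_inv q := by
    conv_rhs => rw [← RightCosets.mk_out q]
    rw [RightCosets.mk_eq_iff]
    have := (RightCosets.mk_eq_iff H).1 (RightCosets.mk_out (RightCosets.mk H (q.out * y⁻¹)))
    simpa [mul_assoc] using this

theorem cosetSum_translate {H : Subgroup Γ} {F : Γ → ℂ} (hF : LeftInv H F) (y : Γ) :
    cosetSum H (fun x => F (x * y)) = cosetSum H F := by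
  unfold cosetSum
  rw [← finsum_comp_equiv (f := fun q : RightCosets H => F q.out) (RightCosets.translate H y)]
  refine finsum_congr fun q => ?_
  exact (hF.out_mk _).symm

/-- The right cosets on which `F` does not vanish. -/
def cosetSupport (H : Subgroup Γ) (F : Γ → ℂ) : Set (RightCosets H) := {q | F q.out ≠ 0}

theorem finite_rightCosets {H : Subgroup Γ} (hH : IsHeckePair H) (γ : Γ) :
    (RightCosets.mk H '' DoubleCoset.doubleCoset γ H H).Finite := by
  have h := (hH γ⁻¹).image (fun q : Γ ⧸ H => RightCosets.mk H q.out⁻¹)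
  refine h.subset ?_
  rintro _ ⟨x, hx, rfl⟩
  rw [DoubleCoset.mem_doubleCoset] at hx
  obtain ⟨a, ha, b, hb, rfl⟩ := hx
  refine ⟨_, ⟨(a * γ * b)⁻¹, ?_, rfl⟩, ?_⟩
  · rw [DoubleCoset.mem_doubleCoset]
    exact ⟨b⁻¹, H.inv_mem hb, a⁻¹, H.inv_mem ha, by group⟩
  · rw [RightCosets.mk_eq_iff]
    obtain ⟨h, hh⟩ := QuotientGroup.mk_out_eq_mul H (a * γ * b)⁻¹
    rw [hh]
    simp [mul_assoc]

theorem finite_cosetSupport {H : Subgroup Γ} (hH : IsHeckePair H) {f : Γ → ℂ}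
    (hf : f ∈ heckeSubmodule H) : (cosetSupport H f).Finite := by
  have h := hf.2.2.biUnion (t := fun d => RightCosets.mk H '' DoubleCoset.doubleCoset d.out H H)
    fun d _ => finite_rightCosets hH d.out
  refine h.subset ?_
  intro q hq
  simp only [Set.mem_iUnion]
  refine ⟨DoubleCoset.mk H H q.out, ⟨_, hq, rfl⟩, q.out, ?_, RightCosets.mk_out q⟩
  obtain ⟨a, b, ha, hb, hab⟩ := DoubleCoset.mk_out_eq_mul H H q.out
  rw [hab, DoubleCoset.mem_doubleCoset]
  exact ⟨a⁻¹, H.inv_mem ha, b⁻¹, H.inv_mem hb, by group⟩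

theorem leftInv_conv {H : Subgroup Γ} {f g : Γ → ℂ} (hf : f ∈ heckeSubmodule H)
    (hg : g ∈ heckeSubmodule H) (γ : Γ) : LeftInv H fun x => f (γ * x⁻¹) * g x := by
  intro h hh x
  simp only [mul_inv_rev, hg.1 h hh, ← mul_assoc, hf.2.1 _ (H.inv_mem hh)]

theorem heckeConv_mem {H : Subgroup Γ} (hH : IsHeckePair H) {f g : Γ → ℂ}
    (hf : f ∈ heckeSubmodule H) (hg : g ∈ heckeSubmodule H) :
    heckeConv H f g ∈ heckeSubmodule H := by
  refine ⟨?_, ?_, ?_⟩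
  · intro h hh x
    simp only [heckeConv, mul_assoc, hf.1 h hh]
  · intro h hh x
    unfold heckeConv
    rw [← cosetSum_translate (leftInv_conv hf hg (x * h)) h]
    simp [hg.2.1 h hh, mul_assoc]
  · have hfin : (⋃ q ∈ cosetSupport H g,
        (fun r : RightCosets H => DoubleCoset.mk H H (r.out * q.out)) '' cosetSupport H f).Finite :=
      (finite_cosetSupport hH hg).biUnion fun q _ => (finite_cosetSupport hH hf).image _
    refine hfin.subset ?_
    rintro _ ⟨γ, hγ, rfl⟩
    obtain ⟨q, hq⟩ : ∃ q : RightCosets H, f (γ * q.out⁻¹) * g q.out ≠ 0 := by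
      by_contra! h
      exact hγ (by simp [heckeConv, cosetSum, h])
    have hq1 := left_ne_zero_of_mul hq
    have hq2 := right_ne_zero_of_mul hq
    simp only [Set.mem_iUnion]
    refine ⟨q, hq2, RightCosets.mk H (γ * q.out⁻¹), ?_, ?_⟩
    · change f _ ≠ 0
      rwa [LeftInv.out_mk hf.1]
    · have := (RightCosets.mk_eq_iff H).1 (RightCosets.mk_out (RightCosets.mk H (γ * q.out⁻¹)))
      rw [DoubleCoset.eq]
      exact ⟨_, this, 1, H.one_mem, by simp⟩

theorem heckeStar_mem {H : Subgroup Γ} {f : Γ → ℂ} (hf : f ∈ heckeSubmodule H) :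
    heckeStar f ∈ heckeSubmodule H := by
  refine ⟨?_, ?_, ?_⟩
  · intro h hh x
    simp only [heckeStar, mul_inv_rev, hf.2.1 _ (H.inv_mem hh)]
  · intro h hh x
    simp only [heckeStar, mul_inv_rev, hf.1 _ (H.inv_mem hh)]
  · refine (hf.2.2.image fun d => DoubleCoset.mk H H d.out⁻¹).subset ?_
    rintro _ ⟨γ, hγ, rfl⟩
    have hγ' : f γ⁻¹ ≠ 0 := by simpa [heckeStar] using hγ
    refine ⟨_, ⟨γ⁻¹, hγ', rfl⟩, ?_⟩
    obtain ⟨a, b, ha, hb, hab⟩ := DoubleCoset.mk_out_eq_mul H H γ⁻¹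
    simp only [hab]
    rw [DoubleCoset.eq]
    exact ⟨b, hb, a, ha, by group⟩

/-- The characteristic function `[γ]` of the double coset `HγH`. -/
def heckeChar (H : Subgroup Γ) (γ : Γ) : Γ → ℂ :=
  (DoubleCoset.doubleCoset γ (H : Set Γ) H).indicator fun _ => 1

theorem heckeChar_mem (H : Subgroup Γ) (γ : Γ) : heckeChar H γ ∈ heckeSubmodule H := by
  have key : ∀ x y : Γ, (∃ a ∈ H, ∃ b ∈ H, y = a * x * b) → heckeChar H γ y = heckeChar H γ x := by
    rintro x y ⟨a, ha, b, hb, rfl⟩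
    have : a * x * b ∈ DoubleCoset.doubleCoset γ (H : Set Γ) H ↔
        x ∈ DoubleCoset.doubleCoset γ (H : Set Γ) H := by
      simp only [DoubleCoset.mem_doubleCoset]
      constructor
      · rintro ⟨u, hu, v, hv, h⟩
        refine ⟨a⁻¹ * u, H.mul_mem (H.inv_mem ha) hu, v * b⁻¹, H.mul_mem hv (H.inv_mem hb), ?_⟩
        have : x = a⁻¹ * (a * x * b) * b⁻¹ := by group
        rw [this, h]; group
      · rintro ⟨u, hu, v, hv, rfl⟩
        exact ⟨a * u, H.mul_mem ha hu, v * b, H.mul_mem hv hb, by group⟩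
    unfold heckeChar
    by_cases hx : x ∈ DoubleCoset.doubleCoset γ (H : Set Γ) H
    · rw [Set.indicator_of_mem hx, Set.indicator_of_mem (this.2 hx)]
    · rw [Set.indicator_of_notMem hx, Set.indicator_of_notMem (mt this.1 hx)]
  refine ⟨fun h hh x => key _ _ ⟨h, hh, 1, H.one_mem, by simp⟩,
    fun h hh x => key _ _ ⟨1, H.one_mem, h, hh, by simp⟩, ?_⟩
  refine (Set.finite_singleton (DoubleCoset.mk H H γ)).subset ?_
  rintro _ ⟨x, hx, rfl⟩
  have hx : x ∈ DoubleCoset.doubleCoset γ (H : Set Γ) H := by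
    by_contra h
    exact hx (Set.indicator_of_notMem h _)
  rw [DoubleCoset.mem_doubleCoset] at hx
  rw [Set.mem_singleton_iff, eq_comm, DoubleCoset.eq]
  exact hx

theorem heckeChar_one (H : Subgroup Γ) [DecidablePred (· ∈ H)] (x : Γ) :
    heckeChar H 1 x = if x ∈ H then 1 else 0 := by
  have : x ∈ DoubleCoset.doubleCoset 1 (H : Set Γ) H ↔ x ∈ H := by
    rw [DoubleCoset.mem_doubleCoset]
    constructor
    · rintro ⟨a, ha, b, hb, rfl⟩
      simpa using H.mul_mem ha hb
    · intro hx
      exact ⟨x, hx, 1, H.one_mem, by simp⟩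
  unfold heckeChar
  by_cases hx : x ∈ H
  · rw [if_pos hx, Set.indicator_of_mem (this.2 hx)]
  · rw [if_neg hx, Set.indicator_of_notMem (mt this.1 hx)]

theorem hasFiniteSupport_conv {H : Subgroup Γ} (hH : IsHeckePair H) (f : Γ → ℂ) {g : Γ → ℂ}
    (hg : g ∈ heckeSubmodule H) (γ : Γ) :
    (Function.support fun q : RightCosets H => f (γ * q.out⁻¹) * g q.out).Finite :=
  (finite_cosetSupport hH hg).subset fun _ hq => right_ne_zero_of_mul hq

theorem heckeConv_add {H : Subgroup Γ} (hH : IsHeckePair H) (f : Γ → ℂ) {g k : Γ → ℂ}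
    (hg : g ∈ heckeSubmodule H) (hk : k ∈ heckeSubmodule H) :
    heckeConv H f (g + k) = heckeConv H f g + heckeConv H f k := by
  funext γ
  simp only [heckeConv, cosetSum, Pi.add_apply, mul_add]
  exact finsum_add_distrib (hasFiniteSupport_conv hH f hg γ) (hasFiniteSupport_conv hH f hk γ)

theorem add_heckeConv {H : Subgroup Γ} (hH : IsHeckePair H) (f g : Γ → ℂ) {k : Γ → ℂ}
    (hk : k ∈ heckeSubmodule H) :
    heckeConv H (f + g) k = heckeConv H f k + heckeConv H g k := by
  funext γ
  simp only [heckeConv, cosetSum, Pi.add_apply, add_mul]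
  exact finsum_add_distrib (hasFiniteSupport_conv hH f hk γ) (hasFiniteSupport_conv hH g hk γ)

theorem smul_heckeConv (H : Subgroup Γ) (c : ℂ) (f g : Γ → ℂ) :
    heckeConv H (c • f) g = c • heckeConv H f g := by
  funext γ
  simp only [heckeConv, cosetSum, Pi.smul_apply, smul_eq_mul, mul_assoc]
  exact (mul_finsum _ _).symm

theorem heckeConv_smul (H : Subgroup Γ) (c : ℂ) (f g : Γ → ℂ) :
    heckeConv H f (c • g) = c • heckeConv H f g := by
  funext γ
  simp only [heckeConv, cosetSum, Pi.smul_apply, smul_eq_mul, mul_left_comm _ c]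
  exact (mul_finsum _ _).symm

theorem one_heckeConv {H : Subgroup Γ} {g : Γ → ℂ} (hg : g ∈ heckeSubmodule H) :
    heckeConv H (heckeChar H 1) g = g := by
  classical
  funext γ
  unfold heckeConv cosetSum
  rw [finsum_eq_single _ (RightCosets.mk H γ)]
  · have h1 := (RightCosets.mk_eq_iff H).1 (RightCosets.mk_out (RightCosets.mk H γ))
    beta_reduce
    rw [heckeChar_one, if_pos h1, one_mul, LeftInv.out_mk hg.1]
  · intro q hq
    beta_reduce
    rw [heckeChar_one, if_neg, zero_mul]
    intro h
    rw [← RightCosets.mk_eq_iff, RightCosets.mk_out] at h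
    exact hq h

theorem heckeConv_one {H : Subgroup Γ} {f : Γ → ℂ} (hf : f ∈ heckeSubmodule H) :
    heckeConv H f (heckeChar H 1) = f := by
  classical
  funext γ
  unfold heckeConv cosetSum
  have hm : ∀ q : RightCosets H, q.out ∈ H ↔ q = RightCosets.mk H 1 := by
    intro q
    conv_rhs => rw [← RightCosets.mk_out q, eq_comm, RightCosets.mk_eq_iff]
    simp
  rw [finsum_eq_single _ (RightCosets.mk H 1)]
  · have h1 := (hm (RightCosets.mk H 1)).2 rfl
    beta_reduce
    rw [heckeChar_one, if_pos h1, mul_one, hf.2.1 _ (H.inv_mem h1)]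
  · intro q hq
    beta_reduce
    rw [heckeChar_one, if_neg (mt (hm q).1 hq), mul_zero]

theorem heckeConv_assoc {H : Subgroup Γ} (hH : IsHeckePair H) {f g k : Γ → ℂ}
    (hf : f ∈ heckeSubmodule H) (hg : g ∈ heckeSubmodule H) (hk : k ∈ heckeSubmodule H) :
    heckeConv H (heckeConv H f g) k = heckeConv H f (heckeConv H g k) := by
  funext γ
  have hK := finite_cosetSupport hH hk
  have e1 : ∀ x : RightCosets H, heckeConv H f g (γ * x.out⁻¹) * k x.out =
      ∑ᶠ z : RightCosets H, f (γ * z.out⁻¹) * (g (z.out * x.out⁻¹) * k x.out) := by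
    intro x
    have hL : LeftInv H fun z => f (γ * z⁻¹) * g (z * x.out⁻¹) := by
      intro h hh z
      simp only [mul_inv_rev, mul_assoc, hg.1 h hh]
      simp only [← mul_assoc, hf.2.1 _ (H.inv_mem hh)]
    have h2 := cosetSum_translate hL x.out
    simp only [mul_inv_rev, ← mul_assoc, mul_inv_cancel_right] at h2
    unfold heckeConv
    simp only [← mul_assoc]
    rw [h2, cosetSum, finsum_mul]
  have hsupp : ∀ x : RightCosets H, (Function.support fun z : RightCosets H =>
      f (γ * z.out⁻¹) * (g (z.out * x.out⁻¹) * k x.out)).Finite := by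
    intro x
    refine ((finite_cosetSupport hH hg).image (RightCosets.translate H x.out)).subset ?_
    intro z hz
    have hz' : g (z.out * x.out⁻¹) ≠ 0 := left_ne_zero_of_mul (right_ne_zero_of_mul hz)
    refine ⟨(RightCosets.translate H x.out).symm z, ?_, Equiv.apply_symm_apply _ _⟩
    change g _ ≠ 0
    rw [show (RightCosets.translate H x.out).symm z = RightCosets.mk H (z.out * x.out⁻¹) from rfl,
      LeftInv.out_mk hg.1]
    exact hz'
  have hout : (Function.support fun x : RightCosets H =>
      heckeConv H f g (γ * x.out⁻¹) * k x.out) ⊆ hK.toFinset := by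
    intro x hx
    exact hK.mem_toFinset.2 (right_ne_zero_of_mul hx)
  have hin : ∀ z : RightCosets H, (Function.support fun x : RightCosets H =>
      f (γ * z.out⁻¹) * (g (z.out * x.out⁻¹) * k x.out)) ⊆ hK.toFinset := by
    intro z x hx
    exact hK.mem_toFinset.2 (right_ne_zero_of_mul (right_ne_zero_of_mul hx))
  have lhs : heckeConv H (heckeConv H f g) k γ = ∑ x ∈ hK.toFinset,
      ∑ᶠ z : RightCosets H, f (γ * z.out⁻¹) * (g (z.out * x.out⁻¹) * k x.out) := by
    rw [heckeConv, cosetSum, finsum_eq_sum_of_support_subset _ hout]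
    exact Finset.sum_congr rfl fun x _ => e1 x
  have rhs : heckeConv H f (heckeConv H g k) γ = ∑ᶠ z : RightCosets H,
      ∑ x ∈ hK.toFinset, f (γ * z.out⁻¹) * (g (z.out * x.out⁻¹) * k x.out) := by
    rw [heckeConv, cosetSum]
    refine finsum_congr fun z => ?_
    rw [heckeConv, cosetSum, mul_finsum, finsum_eq_sum_of_support_subset _ (hin z)]
  rw [lhs, rhs]
  exact (finsum_sum_comm _ _ fun x _ => hsupp x).symm

theorem heckeStar_conv {H : Subgroup Γ} {f g : Γ → ℂ}
    (hf : f ∈ heckeSubmodule H) (hg : g ∈ heckeSubmodule H) :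
    heckeStar (heckeConv H f g) = heckeConv H (heckeStar g) (heckeStar f) := by
  funext γ
  have hL := leftInv_conv hf hg γ⁻¹
  have h2 := cosetSum_translate hL γ⁻¹
  have h3 : ∀ F : Γ → ℂ, conj (cosetSum H F) = cosetSum H fun x => conj (F x) := by
    intro F
    exact (starRingEnd ℂ).toAddMonoidHom.map_finsum_of_injective
      (RingHom.injective _) _
  unfold heckeStar
  rw [heckeConv, ← h2, h3]
  unfold heckeConv
  congr 1
  funext x
  simp [mul_comm]

variable {H : Subgroup Γ}

/-- The Hecke *-algebra `𝓗(Γ, H)` of a Hecke pair. -/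
def HeckeAlgebra (_hH : IsHeckePair H) : Type u := heckeSubmodule H

namespace HeckeAlgebra

variable (hH : IsHeckePair H)

instance : AddCommGroup (HeckeAlgebra hH) := inferInstanceAs (AddCommGroup (heckeSubmodule H))

instance : Module ℂ (HeckeAlgebra hH) := inferInstanceAs (Module ℂ (heckeSubmodule H))

instance : Ring (HeckeAlgebra hH) where
  __ := (inferInstance : AddCommGroup (HeckeAlgebra hH))
  mul f g := ⟨heckeConv H f.1 g.1, heckeConv_mem hH f.2 g.2⟩
  one := ⟨heckeChar H 1, heckeChar_mem H 1⟩
  mul_assoc f g k := Subtype.ext (heckeConv_assoc hH f.2 g.2 k.2)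
  one_mul f := Subtype.ext (one_heckeConv f.2)
  mul_one f := Subtype.ext (heckeConv_one f.2)
  left_distrib f g k := Subtype.ext (heckeConv_add hH f.1 g.2 k.2)
  right_distrib f g k := Subtype.ext (add_heckeConv hH f.1 g.1 k.2)
  zero_mul f := Subtype.ext (by
    have := smul_heckeConv H 0 f.1 f.1
    rw [zero_smul, zero_smul] at this
    exact this)
  mul_zero f := Subtype.ext (by
    have := heckeConv_smul H 0 f.1 f.1
    rw [zero_smul, zero_smul] at this
    exact this)

instance : Algebra ℂ (HeckeAlgebra hH) :=
  Algebra.ofModule (fun c f g => Subtype.ext (smul_heckeConv H c f.1 g.1))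
    (fun c f g => Subtype.ext (heckeConv_smul H c f.1 g.1))

instance : StarRing (HeckeAlgebra hH) where
  star f := ⟨heckeStar f.1, heckeStar_mem f.2⟩
  star_involutive f := Subtype.ext (by funext x; simp [heckeStar])
  star_mul f g := Subtype.ext (heckeStar_conv f.2 g.2)
  star_add f g := Subtype.ext (by
    funext x
    exact map_add (starRingEnd ℂ) (f.1 x⁻¹) (g.1 x⁻¹))

instance : StarModule ℂ (HeckeAlgebra hH) where
  star_smul c f := Subtype.ext (by
    funext x
    exact map_mul (starRingEnd ℂ) c (f.1 x⁻¹))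

/-- `[γ]` as an element of the Hecke algebra. -/
def char (γ : Γ) : HeckeAlgebra hH := ⟨heckeChar H γ, heckeChar_mem H γ⟩

end HeckeAlgebra

end Hecke

/-! ### The *-algebra structure of a complex group algebra -/

section GroupAlgebra

variable (G : Type u) [Group G]

/-- The involution of the complex group algebra, `(∑ c_g g)* = ∑ conj(c_g) g⁻¹`. -/
def groupAlgebraStar : MonoidAlgebra ℂ G →+ MonoidAlgebra ℂ G where
  toFun f := f.coeff.sum fun g c => MonoidAlgebra.single g⁻¹ (conj c)
  map_zero' := by simp
  map_add' f g := by
    rw [MonoidAlgebra.coeff_add]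
    exact Finsupp.sum_add_index' (by simp) (by simp [MonoidAlgebra.single_add])

theorem groupAlgebraStar_single (g : G) (c : ℂ) :
    groupAlgebraStar G (MonoidAlgebra.single g c) = MonoidAlgebra.single g⁻¹ (conj c) :=
  (Finsupp.sum_single_index (by simp) :
    (Finsupp.single g c).sum (fun g c => MonoidAlgebra.single g⁻¹ (conj c)) = _)

instance : StarRing (MonoidAlgebra ℂ G) where
  star := groupAlgebraStar G
  star_involutive x := by
    induction x using MonoidAlgebra.induction_linear with
    | zero => simp
    | add f g hf hg => rw [map_add, map_add, hf, hg]
    | single g c => simp [groupAlgebraStar_single]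
  star_mul x y := by
    change groupAlgebraStar G (x * y) = groupAlgebraStar G y * groupAlgebraStar G x
    induction x using MonoidAlgebra.induction_linear with
    | zero => simp
    | add f g hf hg => rw [add_mul, map_add, map_add, hf, hg, mul_add]
    | single g c =>
      induction y using MonoidAlgebra.induction_linear with
      | zero => simp
      | add f' g' hf hg => rw [mul_add, map_add, map_add, hf, hg, add_mul]
      | single g' c' =>
        simp [groupAlgebraStar_single, MonoidAlgebra.single_mul_single, mul_comm]
  star_add x y := map_add (groupAlgebraStar G) x y

theorem MonoidAlgebra.star_single_complex (g : G) (c : ℂ) :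
    star (MonoidAlgebra.single g c) = MonoidAlgebra.single g⁻¹ (conj c) :=
  groupAlgebraStar_single G g c

instance : StarModule ℂ (MonoidAlgebra ℂ G) where
  star_smul c x := by
    change groupAlgebraStar G (c • x) = conj c • groupAlgebraStar G x
    induction x using MonoidAlgebra.induction_linear with
    | zero => simp
    | add f g hf hg => rw [smul_add, map_add, map_add, hf, hg, smul_add]
    | single g d => simp [groupAlgebraStar_single, MonoidAlgebra.smul_single]

end GroupAlgebra

/-! ### The *-algebraic semigroup crossed product -/

section CrossedProduct

variable {A : Type u} [Ring A] [StarRing A] [Algebra ℂ A]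
  {S : Type v} [Semigroup S]

/-- The generators of the crossed product: the elements of `A`, the isometries `v_s`, and their
adjoints `v_s*`. -/
inductive CrossedProductGen (A : Type u) (S : Type v) : Type (max u v)
  | elt : A → CrossedProductGen A S
  | iso : S → CrossedProductGen A S
  | coiso : S → CrossedProductGen A S

open CrossedProductGen in
/-- The defining relations: the elements of `A` multiply and add as in the unital algebra `A`,
`v` is a representation of `S` by isometries, and `v_s a v_s* = α_s(a)`. -/
inductive CrossedProductRel (α : S →ₙ* (A →⋆ₙₐ[ℂ] A)) :
    FreeAlgebra ℂ (CrossedProductGen A S) → FreeAlgebra ℂ (CrossedProductGen A S) → Prop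
  | add (a b : A) : CrossedProductRel α (FreeAlgebra.ι ℂ (elt (a + b)))
      (FreeAlgebra.ι ℂ (elt a) + FreeAlgebra.ι ℂ (elt b))
  | mul (a b : A) : CrossedProductRel α (FreeAlgebra.ι ℂ (elt (a * b)))
      (FreeAlgebra.ι ℂ (elt a) * FreeAlgebra.ι ℂ (elt b))
  | scalar (c : ℂ) : CrossedProductRel α (FreeAlgebra.ι ℂ (elt (algebraMap ℂ A c)))
      (algebraMap ℂ _ c)
  | iso_mul (s t : S) : CrossedProductRel α (FreeAlgebra.ι ℂ (iso (s * t)))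
      (FreeAlgebra.ι ℂ (iso s) * FreeAlgebra.ι ℂ (iso t))
  | coiso_mul (s t : S) : CrossedProductRel α (FreeAlgebra.ι ℂ (coiso (s * t)))
      (FreeAlgebra.ι ℂ (coiso t) * FreeAlgebra.ι ℂ (coiso s))
  | isometry (s : S) : CrossedProductRel α
      (FreeAlgebra.ι ℂ (coiso s) * FreeAlgebra.ι ℂ (iso s)) 1
  | covariance (s : S) (a : A) : CrossedProductRel α
      (FreeAlgebra.ι ℂ (iso s) * FreeAlgebra.ι ℂ (elt a) * FreeAlgebra.ι ℂ (coiso s))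
      (FreeAlgebra.ι ℂ (elt (α s a)))

/-- The *-algebraic semigroup crossed product `A ⋊_α S`: the universal unital *-algebra generated
by a unital copy of `A` and a representation `v` of `S` by isometries with
`v_s a v_s* = α_s(a)`. -/
def CrossedProduct (α : S →ₙ* (A →⋆ₙₐ[ℂ] A)) : Type (max u v) :=
  RingQuot (CrossedProductRel α)

/-- The opposite algebra of `Q` with the complex conjugate scalar multiplication. -/
def ConjOp (Q : Type w) : Type w := Qᵐᵒᵖ

instance (Q : Type w) [Ring Q] : Ring (ConjOp Q) := inferInstanceAs (Ring Qᵐᵒᵖ)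

instance (Q : Type w) [Ring Q] [Algebra ℂ Q] : Algebra ℂ (ConjOp Q) :=
  RingHom.toAlgebra' ((algebraMap ℂ Qᵐᵒᵖ).comp (starRingEnd ℂ)) fun c x =>
    Algebra.commutes (A := Qᵐᵒᵖ) (conj c) x

/-- `x : Q` as an element of `ConjOp Q`. -/
def ConjOp.op {Q : Type w} (x : Q) : ConjOp Q := MulOpposite.op x

/-- An element of `ConjOp Q` as an element of `Q`. -/
def ConjOp.unop {Q : Type w} (x : ConjOp Q) : Q := MulOpposite.unop x

section ConjOp

theorem ConjOp.unop_op {Q : Type w} (x : Q) : (ConjOp.op x).unop = x := rfl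

theorem ConjOp.unop_injective {Q : Type w} {x y : ConjOp Q} (h : x.unop = y.unop) : x = y :=
  MulOpposite.unop_injective h

variable {Q : Type w} [Ring Q]

theorem ConjOp.unop_mul (x y : ConjOp Q) : (x * y).unop = y.unop * x.unop := rfl

theorem ConjOp.unop_add (x y : ConjOp Q) : (x + y).unop = x.unop + y.unop := rfl

theorem ConjOp.unop_one : (1 : ConjOp Q).unop = 1 := rfl

theorem ConjOp.unop_algebraMap [Algebra ℂ Q] (c : ℂ) :
    (algebraMap ℂ (ConjOp Q) c).unop = algebraMap ℂ Q (conj c) := rfl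

end ConjOp

namespace CrossedProduct

variable (α : S →ₙ* (A →⋆ₙₐ[ℂ] A))

instance : Ring (CrossedProduct α) := inferInstanceAs (Ring (RingQuot (CrossedProductRel α)))

instance : Algebra ℂ (CrossedProduct α) :=
  inferInstanceAs (Algebra ℂ (RingQuot (CrossedProductRel α)))

/-- The quotient map from the free algebra. -/
def mk : FreeAlgebra ℂ (CrossedProductGen A S) →ₐ[ℂ] CrossedProduct α :=
  RingQuot.mkAlgHom ℂ (CrossedProductRel α)

theorem mk_rel {x y : FreeAlgebra ℂ (CrossedProductGen A S)} (h : CrossedProductRel α x y) :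
    mk α x = mk α y :=
  RingQuot.mkAlgHom_rel ℂ h

/-- The image of a generator. -/
def gen (g : CrossedProductGen A S) : CrossedProduct α := mk α (FreeAlgebra.ι ℂ g)

theorem induction {P : CrossedProduct α → Prop} (hs : ∀ c, P (algebraMap ℂ _ c))
    (hg : ∀ g, P (gen α g)) (hm : ∀ x y, P x → P y → P (x * y))
    (ha : ∀ x y, P x → P y → P (x + y)) (x : CrossedProduct α) : P x := by
  obtain ⟨y, rfl⟩ : ∃ y, mk α y = x := RingQuot.mkAlgHom_surjective ℂ _ x
  induction y using FreeAlgebra.induction with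
  | grade0 c => rw [AlgHom.commutes]; exact hs c
  | grade1 g => exact hg g
  | mul x y hx hy => rw [map_mul]; exact hm _ _ hx hy
  | add x y hx hy => rw [map_add]; exact ha _ _ hx hy

/-- The involution on generators. -/
def starGen : CrossedProductGen A S → CrossedProductGen A S
  | .elt a => .elt (star a)
  | .iso s => .coiso s
  | .coiso s => .iso s

/-- The involution on the free algebra level, as a conjugate linear antihomomorphism. -/
def starFree : FreeAlgebra ℂ (CrossedProductGen A S) →ₐ[ℂ] ConjOp (CrossedProduct α) :=
  FreeAlgebra.lift ℂ fun g => ConjOp.op (gen α (starGen g))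

theorem starFree_ι (g : CrossedProductGen A S) :
    starFree α (FreeAlgebra.ι ℂ g) = ConjOp.op (mk α (FreeAlgebra.ι ℂ (starGen g))) :=
  FreeAlgebra.lift_ι_apply _ _

variable [StarModule ℂ A]

theorem starFree_rel {x y : FreeAlgebra ℂ (CrossedProductGen A S)}
    (h : CrossedProductRel α x y) : starFree α x = starFree α y := by
  apply ConjOp.unop_injective
  cases h with
  | add a b =>
    simpa [starFree_ι, ConjOp.unop_add, ConjOp.unop_op, starGen]
      using mk_rel α (.add (star a) (star b))
  | mul a b =>
    simpa [starFree_ι, ConjOp.unop_mul, ConjOp.unop_op, starGen]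
      using mk_rel α (.mul (star b) (star a))
  | scalar c =>
    simpa [starFree_ι, ConjOp.unop_algebraMap, ConjOp.unop_op, starGen, ← algebraMap_star_comm]
      using mk_rel α (.scalar (conj c))
  | iso_mul s t =>
    simpa [starFree_ι, ConjOp.unop_mul, ConjOp.unop_op, starGen] using mk_rel α (.coiso_mul s t)
  | coiso_mul s t =>
    simpa [starFree_ι, ConjOp.unop_mul, ConjOp.unop_op, starGen] using mk_rel α (.iso_mul s t)
  | isometry s =>
    simpa [starFree_ι, ConjOp.unop_mul, ConjOp.unop_op, ConjOp.unop_one, starGen]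
      using mk_rel α (.isometry s)
  | covariance s a =>
    simpa [starFree_ι, ConjOp.unop_mul, ConjOp.unop_op, starGen, mul_assoc, map_star]
      using mk_rel α (.covariance s (star a))

/-- The involution as a conjugate linear antihomomorphism. -/
def starHom : CrossedProduct α →ₐ[ℂ] ConjOp (CrossedProduct α) :=
  RingQuot.liftAlgHom ℂ (s := CrossedProductRel α) ⟨starFree α, fun _ _ h => starFree_rel α h⟩

theorem starHom_gen (g : CrossedProductGen A S) :
    starHom α (gen α g) = ConjOp.op (gen α (starGen g)) :=
  (RingQuot.liftAlgHom_mkAlgHom_apply ℂ (starFree α) (fun _ _ h => starFree_rel α h)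
    (FreeAlgebra.ι ℂ g)).trans (starFree_ι α g)

instance : Star (CrossedProduct α) := ⟨fun x => (starHom α x).unop⟩

theorem star_def (x : CrossedProduct α) : star x = (starHom α x).unop := rfl

theorem star_gen (g : CrossedProductGen A S) : star (gen α g) = gen α (starGen g) := by
  rw [star_def, starHom_gen, ConjOp.unop_op]

theorem star_algebraMap (c : ℂ) :
    star (algebraMap ℂ (CrossedProduct α) c) = algebraMap ℂ _ (conj c) := by
  rw [star_def, AlgHom.commutes, ConjOp.unop_algebraMap]

theorem star_mul' (x y : CrossedProduct α) : star (x * y) = star y * star x := by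
  rw [star_def, map_mul, ConjOp.unop_mul]; rfl

theorem star_add' (x y : CrossedProduct α) : star (x + y) = star x + star y := by
  rw [star_def, map_add, ConjOp.unop_add]; rfl

instance : StarRing (CrossedProduct α) where
  star_involutive x := by
    induction x using induction with
    | hs c => rw [star_algebraMap, star_algebraMap, Complex.conj_conj]
    | hg g => cases g <;> simp [star_gen, starGen]
    | hm x y hx hy => rw [star_mul', star_mul', hx, hy]
    | ha x y hx hy => rw [star_add', star_add', hx, hy]
  star_mul := star_mul' α
  star_add := star_add' α

instance : StarModule ℂ (CrossedProduct α) where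
  star_smul c x := by
    rw [Algebra.smul_def, star_mul', star_algebraMap, Algebra.smul_def, Algebra.commutes]
    rfl

/-- The canonical map `A → A ⋊_α S`. -/
def coeff : A →⋆ₐ[ℂ] CrossedProduct α where
  toFun a := gen α (.elt a)
  map_one' := by simpa [gen] using mk_rel α (.scalar 1)
  map_mul' a b := by simpa [gen] using mk_rel α (.mul a b)
  map_zero' := by simpa [gen] using mk_rel α (.scalar 0)
  map_add' a b := by simpa [gen] using mk_rel α (.add a b)
  commutes' c := by simpa [gen] using mk_rel α (.scalar c)
  map_star' a := (star_gen α (.elt a)).symm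

/-- The canonical isometry `v_s` in `A ⋊_α S`. -/
def isom (s : S) : CrossedProduct α := gen α (.iso s)

theorem star_isom (s : S) : star (isom α s) = gen α (.coiso s) :=
  star_gen α _

theorem star_isom_mul_self (s : S) : star (isom α s) * isom α s = 1 := by
  rw [star_isom]
  simpa [gen, isom] using mk_rel α (.isometry s)

end CrossedProduct

end CrossedProduct

/-! ### Universal enveloping C*-algebras -/

section Envelope

/-- The norms `‖π(a)‖`, for all unital *-representations `π` of `A` on Hilbert spaces. (For the
values of these norms it is enough to let the Hilbert spaces run through the universe of `A`: every
vector lies in a cyclic subrepresentation, and that space has a dense subset indexed by `A`.) -/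
def repNorms (A : Type u) [Ring A] [StarRing A] [Algebra ℂ A] (a : A) : Set ℝ :=
  {r | ∃ (H : Type u) (_ : NormedAddCommGroup H) (_ : InnerProductSpace ℂ H)
    (_ : CompleteSpace H) (π : A →⋆ₐ[ℂ] (H →L[ℂ] H)), r = ‖π a‖}

/-- The universal C*-algebra of the *-algebra `A` exists: each element of `A` is uniformly bounded
in all *-representations. -/
def HasCStarEnvelope (A : Type u) [Ring A] [StarRing A] [Algebra ℂ A] : Prop :=
  ∀ a : A, BddAbove (repNorms A a)

variable {A : Type u} [Ring A] [StarRing A] [Algebra ℂ A]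

/-- The universal C*-seminorm `‖a‖ = sup_π ‖π(a)‖`. -/
def univNorm (a : A) : ℝ := sSup (repNorms A a)

theorem univNorm_nonneg (a : A) : 0 ≤ univNorm a :=
  Real.sSup_nonneg (by rintro _ ⟨H, _, _, _, π, rfl⟩; exact norm_nonneg _)

theorem univNorm_le {a : A} {C : ℝ} (hC : 0 ≤ C)
    (h : ∀ (H : Type u) [NormedAddCommGroup H] [InnerProductSpace ℂ H] [CompleteSpace H]
      (π : A →⋆ₐ[ℂ] (H →L[ℂ] H)), ‖π a‖ ≤ C) : univNorm a ≤ C :=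
  Real.sSup_le (by rintro _ ⟨H, _, _, _, π, rfl⟩; exact h H π) hC

theorem le_univNorm (hA : HasCStarEnvelope A) (a : A) {H : Type u} [NormedAddCommGroup H]
    [InnerProductSpace ℂ H] [CompleteSpace H] (π : A →⋆ₐ[ℂ] (H →L[ℂ] H)) :
    ‖π a‖ ≤ univNorm a :=
  le_csSup (hA a) ⟨H, _, _, _, π, rfl⟩

theorem univNorm_zero : univNorm (0 : A) = 0 :=
  le_antisymm (univNorm_le le_rfl fun H _ _ _ π => by simp) (univNorm_nonneg 0)

theorem univNorm_add_le (hA : HasCStarEnvelope A) (a b : A) :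
    univNorm (a + b) ≤ univNorm a + univNorm b :=
  univNorm_le (add_nonneg (univNorm_nonneg a) (univNorm_nonneg b)) fun H _ _ _ π => by
    rw [map_add]
    exact (norm_add_le _ _).trans (add_le_add (le_univNorm hA a π) (le_univNorm hA b π))

theorem univNorm_neg (hA : HasCStarEnvelope A) (a : A) : univNorm (-a) = univNorm a := by
  have h : ∀ a : A, univNorm (-a) ≤ univNorm a := fun a =>
    univNorm_le (univNorm_nonneg a) fun H _ _ _ π => by
      rw [map_neg, norm_neg]
      exact le_univNorm hA a π
  exact le_antisymm (h a) (by simpa using h (-a))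

theorem univNorm_mul_le (hA : HasCStarEnvelope A) (a b : A) :
    univNorm (a * b) ≤ univNorm a * univNorm b :=
  univNorm_le (mul_nonneg (univNorm_nonneg a) (univNorm_nonneg b)) fun H _ _ _ π => by
    rw [map_mul]
    exact (norm_mul_le _ _).trans (mul_le_mul (le_univNorm hA a π) (le_univNorm hA b π)
      (norm_nonneg _) (univNorm_nonneg a))

theorem univNorm_smul_le (hA : HasCStarEnvelope A) (c : ℂ) (a : A) :
    univNorm (c • a) ≤ ‖c‖ * univNorm a :=
  univNorm_le (mul_nonneg (norm_nonneg c) (univNorm_nonneg a)) fun H _ _ _ π => by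
    rw [map_smul]
    exact (norm_smul_le _ _).trans
      (mul_le_mul_of_nonneg_left (le_univNorm hA a π) (norm_nonneg c))

theorem univNorm_star (hA : HasCStarEnvelope A) (a : A) : univNorm (star a) = univNorm a := by
  have h : ∀ a : A, univNorm (star a) ≤ univNorm a := fun a =>
    univNorm_le (univNorm_nonneg a) fun H _ _ _ π => by
      rw [map_star, norm_star]
      exact le_univNorm hA a π
  exact le_antisymm (h a) (by simpa using h (star a))

theorem univNorm_mul_self_le (hA : HasCStarEnvelope A) (a : A) :
    univNorm a * univNorm a ≤ univNorm (star a * a) := by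
  have h : univNorm a ≤ √(univNorm (star a * a)) :=
    univNorm_le (Real.sqrt_nonneg _) fun H _ _ _ π => by
      apply Real.le_sqrt_of_sq_le
      have h2 := le_univNorm hA (star a * a) π
      rw [map_mul, map_star, CStarRing.norm_star_mul_self] at h2
      rw [sq]
      exact h2
  calc univNorm a * univNorm a ≤ √(univNorm (star a * a)) * √(univNorm (star a * a)) :=
        mul_self_le_mul_self (univNorm_nonneg a) h
    _ = univNorm (star a * a) := Real.mul_self_sqrt (univNorm_nonneg _)

/-- The *-algebra `A`, to be equipped with the universal C*-seminorm. -/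
def PreCStar (_hA : HasCStarEnvelope A) : Type u := A

namespace PreCStar

variable (hA : HasCStarEnvelope A)

instance : Ring (PreCStar hA) := inferInstanceAs (Ring A)
instance : StarRing (PreCStar hA) := inferInstanceAs (StarRing A)
instance : Algebra ℂ (PreCStar hA) := inferInstanceAs (Algebra ℂ A)
instance [StarModule ℂ A] : StarModule ℂ (PreCStar hA) := inferInstanceAs (StarModule ℂ A)

/-- The universal C*-seminorm as a ring seminorm. -/
def ringSeminorm : RingSeminorm (PreCStar hA) where
  toFun := univNorm (A := A)
  map_zero' := univNorm_zero (A := A)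
  add_le' := univNorm_add_le (A := A) hA
  neg' := univNorm_neg (A := A) hA
  mul_le' := univNorm_mul_le (A := A) hA

instance : SeminormedRing (PreCStar hA) where
  __ := (inferInstance : Ring (PreCStar hA))
  __ := RingSeminorm.toSeminormedRing (ringSeminorm hA)

theorem norm_def (a : PreCStar hA) : ‖a‖ = univNorm (A := A) a := rfl

instance : NormedAlgebra ℂ (PreCStar hA) where
  norm_smul_le := univNorm_smul_le (A := A) hA

theorem norm_star' (a : PreCStar hA) : ‖star a‖ = ‖a‖ := univNorm_star (A := A) hA a

theorem isometry_star : Isometry (star : PreCStar hA → PreCStar hA) :=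
  Isometry.of_dist_eq fun a b => by
    rw [dist_eq_norm, dist_eq_norm, ← star_sub, norm_star']

end PreCStar

/-- The universal enveloping C*-algebra of the *-algebra `A`: the Hausdorff completion of `A` in
the universal C*-seminorm. -/
def CStarEnvelope (hA : HasCStarEnvelope A) : Type u := UniformSpace.Completion (PreCStar hA)

namespace CStarEnvelope

open UniformSpace

variable (hA : HasCStarEnvelope A)

instance : NormedRing (CStarEnvelope hA) :=
  inferInstanceAs (NormedRing (Completion (PreCStar hA)))

instance : CompleteSpace (CStarEnvelope hA) :=
  inferInstanceAs (CompleteSpace (Completion (PreCStar hA)))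

instance : Algebra ℂ (CStarEnvelope hA) :=
  inferInstanceAs (Algebra ℂ (Completion (PreCStar hA)))

/-- The canonical map of `A` to its enveloping C*-algebra, as a function. -/
def coe (a : A) : CStarEnvelope hA := Completion.coe' (show PreCStar hA from a)

theorem coe_add (a b : A) : coe hA (a + b) = coe hA a + coe hA b :=
  Completion.coe_add (α := PreCStar hA) a b

theorem coe_mul (a b : A) : coe hA (a * b) = coe hA a * coe hA b :=
  Completion.coe_mul (α := PreCStar hA) a b

theorem coe_smul (c : ℂ) (a : A) : coe hA (c • a) = c • coe hA a :=
  Completion.coe_smul (X := PreCStar hA) c a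

theorem norm_coe (a : A) : ‖coe hA a‖ = univNorm a := Completion.norm_coe (E := PreCStar hA) a

theorem denseRange_coe : DenseRange (coe hA) := Completion.denseRange_coe (α := PreCStar hA)

theorem ind {P : CStarEnvelope hA → Prop} (hc : IsClosed {x | P x}) (h : ∀ a, P (coe hA a))
    (x : CStarEnvelope hA) : P x := (denseRange_coe hA).induction_on x hc h

instance : NormedAlgebra ℂ (CStarEnvelope hA) where
  norm_smul_le c x :=
    norm_smul_le (α := ℂ) (β := Completion (PreCStar hA)) c x

instance : Star (CStarEnvelope hA) :=
  ⟨Completion.map (star : PreCStar hA → PreCStar hA)⟩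

theorem star_coe (a : A) : star (coe hA a) = coe hA (star a) :=
  Completion.map_coe (PreCStar.isometry_star hA).uniformContinuous _

theorem continuous_star' : Continuous (star : CStarEnvelope hA → CStarEnvelope hA) :=
  Completion.continuous_map

instance : StarRing (CStarEnvelope hA) where
  star_involutive x := by
    induction x using ind with
    | hc =>
      exact isClosed_eq ((continuous_star' hA).comp (continuous_star' hA)) continuous_id
    | h a => rw [star_coe, star_coe, star_star]
  star_mul x y := by
    induction x using ind with
    | hc =>
      exact isClosed_eq ((continuous_star' hA).comp (continuous_id.mul continuous_const))
        (continuous_const.mul (continuous_star' hA))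
    | h a =>
      induction y using ind with
      | hc =>
        exact isClosed_eq ((continuous_star' hA).comp (continuous_const.mul continuous_id))
          ((continuous_star' hA).mul continuous_const)
      | h b => rw [← coe_mul, star_coe, star_coe, star_coe, star_mul, coe_mul]
  star_add x y := by
    induction x using ind with
    | hc =>
      exact isClosed_eq ((continuous_star' hA).comp (continuous_id.add continuous_const))
        ((continuous_star' hA).add continuous_const)
    | h a =>
      induction y using ind with
      | hc =>
        exact isClosed_eq ((continuous_star' hA).comp (continuous_const.add continuous_id))
          (continuous_const.add (continuous_star' hA))
      | h b => rw [← coe_add, star_coe, star_coe, star_coe, star_add, coe_add]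

instance : CStarRing (CStarEnvelope hA) where
  norm_mul_self_le x := by
    induction x using ind with
    | hc =>
      exact isClosed_le (continuous_norm.mul continuous_norm)
        (continuous_norm.comp ((continuous_star' hA).mul continuous_id))
    | h a =>
      rw [star_coe, ← coe_mul, norm_coe, norm_coe]
      exact univNorm_mul_self_le hA a

instance [StarModule ℂ A] : StarModule ℂ (CStarEnvelope hA) where
  star_smul c x := by
    induction x using ind with
    | hc =>
      exact isClosed_eq ((continuous_star' hA).comp (continuous_const_smul c))
        ((continuous_star' hA).const_smul (star c))
    | h a => rw [← coe_smul, star_coe, star_coe, star_smul, coe_smul]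

instance [StarModule ℂ A] : CStarAlgebra (CStarEnvelope hA) where

/-- The canonical *-homomorphism of `A` to its enveloping C*-algebra. -/
def ofAlg : A →⋆ₐ[ℂ] CStarEnvelope hA where
  toFun := coe hA
  map_one' := rfl
  map_mul' := coe_mul hA
  map_zero' := rfl
  map_add' := coe_add hA
  commutes' c := by
    rw [Algebra.algebraMap_eq_smul_one, Algebra.algebraMap_eq_smul_one, coe_smul]
    rfl
  map_star' a := (star_coe hA a).symm

end CStarEnvelope

theorem bddAbove_repNorms_of_le {a : A} (C : ℝ)
    (h : ∀ (H : Type u) [NormedAddCommGroup H] [InnerProductSpace ℂ H] [CompleteSpace H]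
      (π : A →⋆ₐ[ℂ] (H →L[ℂ] H)), ‖π a‖ ≤ C) : BddAbove (repNorms A a) :=
  ⟨C, by rintro _ ⟨H, _, _, _, π, rfl⟩; exact h H π⟩

theorem bddAbove_repNorms_add {a b : A} (ha : BddAbove (repNorms A a))
    (hb : BddAbove (repNorms A b)) : BddAbove (repNorms A (a + b)) := by
  obtain ⟨C, hC⟩ := ha
  obtain ⟨D, hD⟩ := hb
  refine bddAbove_repNorms_of_le (C + D) fun H _ _ _ π => ?_
  rw [map_add]
  exact (norm_add_le _ _).trans (add_le_add (hC ⟨H, _, _, _, π, rfl⟩) (hD ⟨H, _, _, _, π, rfl⟩))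

theorem bddAbove_repNorms_mul {a b : A} (ha : BddAbove (repNorms A a))
    (hb : BddAbove (repNorms A b)) : BddAbove (repNorms A (a * b)) := by
  obtain ⟨C, hC⟩ := ha
  obtain ⟨D, hD⟩ := hb
  refine bddAbove_repNorms_of_le (C * D) fun H _ _ _ π => ?_
  rw [map_mul]
  have h1 : ‖π a‖ ≤ C := hC ⟨H, _, _, _, π, rfl⟩
  exact (norm_mul_le _ _).trans (mul_le_mul h1 (hD ⟨H, _, _, _, π, rfl⟩) (norm_nonneg _)
    ((norm_nonneg _).trans h1))

theorem norm_one_le_of_cstar (B : Type w) [CStarAlgebra B] : ‖(1 : B)‖ ≤ 1 := by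
  have h : ‖(1 : B)‖ * ‖(1 : B)‖ = ‖(1 : B)‖ := by
    simpa using (CStarRing.norm_star_mul_self (x := (1 : B))).symm
  nlinarith [norm_nonneg (1 : B)]

theorem norm_le_one_of_isometry {B : Type w} [CStarAlgebra B] {v : B} (hv : star v * v = 1) :
    ‖v‖ ≤ 1 := by
  have h := CStarRing.norm_star_mul_self (x := v)
  rw [hv] at h
  nlinarith [norm_nonneg v, norm_one_le_of_cstar B]

theorem bddAbove_repNorms_algebraMap (c : ℂ) : BddAbove (repNorms A (algebraMap ℂ A c)) := by
  refine bddAbove_repNorms_of_le ‖c‖ fun H _ _ _ π => ?_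
  rw [AlgHomClass.commutes, Algebra.algebraMap_eq_smul_one]
  refine (norm_smul_le _ _).trans ?_
  have := norm_one_le_of_cstar (H →L[ℂ] H)
  nlinarith [norm_nonneg c]

theorem bddAbove_repNorms_isometry {v : A} (hv : star v * v = 1) : BddAbove (repNorms A v) :=
  bddAbove_repNorms_of_le 1 fun H _ _ _ π =>
    norm_le_one_of_isometry (by rw [← map_star, ← map_mul, hv, map_one])

theorem bddAbove_repNorms_star {v : A} (hv : BddAbove (repNorms A v)) :
    BddAbove (repNorms A (star v)) := by
  obtain ⟨C, hC⟩ := hv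
  refine bddAbove_repNorms_of_le C fun H _ _ _ π => ?_
  rw [map_star, norm_star]
  exact hC ⟨H, _, _, _, π, rfl⟩

end Envelope

/-! ### Full group C*-algebras and C*-algebraic semigroup crossed products -/

theorem hasCStarEnvelope_groupAlgebra (G : Type u) [Group G] :
    HasCStarEnvelope (MonoidAlgebra ℂ G) := by
  intro a
  induction a using MonoidAlgebra.induction_on with
  | of g =>
    refine bddAbove_repNorms_isometry ?_
    rw [MonoidAlgebra.of_apply, MonoidAlgebra.star_single_complex,
      MonoidAlgebra.single_mul_single, MonoidAlgebra.one_def]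
    simp
  | add f g hf hg => exact bddAbove_repNorms_add hf hg
  | smul c f hf =>
    rw [Algebra.smul_def]
    exact bddAbove_repNorms_mul (bddAbove_repNorms_algebraMap c) hf

/-- The full group C*-algebra `C*(G)` of a discrete group `G`. -/
abbrev GroupCStar (G : Type u) [Group G] : Type u :=
  CStarEnvelope (hasCStarEnvelope_groupAlgebra G)

/-- The canonical map `ℂ G → C*(G)`. -/
abbrev GroupCStar.ofAlg (G : Type u) [Group G] : MonoidAlgebra ℂ G →⋆ₐ[ℂ] GroupCStar G :=
  CStarEnvelope.ofAlg _

section CStarCrossedProduct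

variable {A : Type u} [CStarAlgebra A] {S : Type v} [Semigroup S]

theorem hasCStarEnvelope_crossedProduct (α : S →ₙ* (A →⋆ₙₐ[ℂ] A)) :
    HasCStarEnvelope (CrossedProduct α) := by
  intro x
  induction x using CrossedProduct.induction with
  | hs c => exact bddAbove_repNorms_algebraMap c
  | hm x y hx hy => exact bddAbove_repNorms_mul hx hy
  | ha x y hx hy => exact bddAbove_repNorms_add hx hy
  | hg g =>
    cases g with
    | iso s => exact bddAbove_repNorms_isometry (CrossedProduct.star_isom_mul_self α s)
    | coiso s =>
      rw [← CrossedProduct.star_isom]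
      exact bddAbove_repNorms_star
        (bddAbove_repNorms_isometry (CrossedProduct.star_isom_mul_self α s))
    | elt a =>
      refine bddAbove_repNorms_of_le ‖a‖ fun H _ _ _ π => ?_
      exact NonUnitalStarAlgHom.norm_apply_le (π.comp (CrossedProduct.coeff α)) a

/-- The C*-algebraic semigroup crossed product `A ⋊_α S` of a unital C*-algebra: the enveloping
C*-algebra of the *-algebraic crossed product. Its representations are thus the covariant pairs
`(π, V)`, with `π` a unital *-representation of `A` and `V` a representation of `S` by isometries
such that `V_s π(a) V_s* = π(α_s(a))`. -/
abbrev CStarCrossedProduct (α : S →ₙ* (A →⋆ₙₐ[ℂ] A)) : Type (max u v) :=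
  CStarEnvelope (hasCStarEnvelope_crossedProduct α)

/-- The canonical map of the *-algebraic crossed product to the C*-algebraic one. -/
abbrev CStarCrossedProduct.ofAlg (α : S →ₙ* (A →⋆ₙₐ[ℂ] A)) :
    CrossedProduct α →⋆ₐ[ℂ] CStarCrossedProduct α :=
  CStarEnvelope.ofAlg _

end CStarCrossedProduct

end

noncomputable section

/-! ### Products of double cosets -/

section HeckeProducts

variable {Γ : Type u} [Group Γ] {H : Subgroup Γ}

/-! Write `H` for the copy of `Γ₀` in `Γ`. Everything rests on the subsemigroup of those γ with
γ⁻¹Hγ ⊂ H, which contains both `N` and `S`. For such γ the double coset is a single left coset, HγH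
= γH, and Hγ⁻¹H = Hγ⁻¹ is a single right coset. Hence left multiplication by [γ] and right
multiplication by [γ⁻¹] merely translate functions. This gives [a][b] = [ab] on the subsemigroup
(`char_mul_char`) and [γ]*[γ] = R(γ)·1 (`char_inv_mul_char_self`), so that v_s = R(s)^{-1/2}[s] is a
representation of `S` by isometries. Conjugation by v_s is f ↦ R(s)⁻¹ f(s⁻¹·s). It preserves the
functions supported on `N`, which form a copy of ℂ(N/Γ₀). The action α is defined to be this
conjugation. Covariance then holds by construction, and the universal property gives a
*-homomorphism from the crossed product to the Hecke algebra.

For bijectivity, S⁻¹S = G makes every element of Γ of the form t⁻¹xs with t, s ∈ S and x ∈ N, and it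
gives `S` common left multiples. The latter show that the monomials v_t* e(x) v_s span the crossed
product (`mem_monomialSpan`) and that such a monomial depends only on the double coset of t⁻¹xs
(`monomial_eq_of_mem_doubleCoset`). Its image is a nonzero multiple of [t⁻¹xs]
(`crossedProductToHecke_monomial`). A spanning family indexed by the double cosets is thus sent, up
to nonzero scalars, to a basis.

For the C*-algebras, α_s is in general not unital, so its boundedness in the universal norm needs an
argument: a *-homomorphism on a group algebra becomes unital after adding the trivial character on
the complementary corner (`univNorm_nonUnitalStarAlgHom_le`). Every representation of the algebraic
crossed product of ℂ(N/Γ₀) then extends to that of C*(N/Γ₀), so the universal norms agree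
(`univNorm_toGroupCStar`), and density finishes the proof. -/

theorem mem_doubleCoset_iff_of_conj_mem {γ : Γ} (hγ : ∀ h ∈ H, γ * h * γ⁻¹ ∈ H) {k : Γ} :
    k ∈ DoubleCoset.doubleCoset γ (H : Set Γ) H ↔ k * γ⁻¹ ∈ H := by
  rw [DoubleCoset.mem_doubleCoset]
  constructor
  · rintro ⟨a, ha, b, hb, rfl⟩
    simpa [mul_assoc] using H.mul_mem ha (hγ b hb)
  · intro h
    exact ⟨k * γ⁻¹, h, 1, H.one_mem, by group⟩

theorem inv_mem_doubleCoset_inv {γ k : Γ} :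
    k⁻¹ ∈ DoubleCoset.doubleCoset γ (H : Set Γ) H ↔
      k ∈ DoubleCoset.doubleCoset γ⁻¹ (H : Set Γ) H := by
  simp only [DoubleCoset.mem_doubleCoset]
  constructor
  · rintro ⟨a, ha, b, hb, h⟩
    exact ⟨b⁻¹, H.inv_mem hb, a⁻¹, H.inv_mem ha, by rw [← inv_inv k, h]; group⟩
  · rintro ⟨a, ha, b, hb, rfl⟩
    exact ⟨b⁻¹, H.inv_mem hb, a⁻¹, H.inv_mem ha, by group⟩

theorem heckeChar_of_mem {γ k : Γ} (h : k ∈ DoubleCoset.doubleCoset γ (H : Set Γ) H) :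
    heckeChar H γ k = 1 := Set.indicator_of_mem h _

theorem heckeChar_of_notMem {γ k : Γ} (h : k ∉ DoubleCoset.doubleCoset γ (H : Set Γ) H) :
    heckeChar H γ k = 0 := Set.indicator_of_notMem h _

theorem heckeChar_self (γ : Γ) : heckeChar H γ γ = 1 :=
  heckeChar_of_mem (DoubleCoset.mem_doubleCoset_self H H γ)

theorem heckeChar_congr {γ k : Γ} (h : k ∈ DoubleCoset.doubleCoset γ (H : Set Γ) H) :
    heckeChar H k = heckeChar H γ := by
  unfold heckeChar
  rw [DoubleCoset.doubleCoset_eq_of_mem h]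

/-- Since HγH is the single right coset Hγ, only one term of the convolution sum survives. -/
theorem heckeConv_char_right {f : Γ → ℂ} (hf : f ∈ heckeSubmodule H) {γ : Γ}
    (hγ : ∀ h ∈ H, γ * h * γ⁻¹ ∈ H) (k : Γ) :
    heckeConv H f (heckeChar H γ) k = f (k * γ⁻¹) := by
  have hm : ∀ q : RightCosets H, q.out ∈ DoubleCoset.doubleCoset γ (H : Set Γ) H ↔
      q = RightCosets.mk H γ := by
    intro q
    conv_rhs => rw [← RightCosets.mk_out q, eq_comm, RightCosets.mk_eq_iff]
    exact mem_doubleCoset_iff_of_conj_mem hγ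
  unfold heckeConv cosetSum
  rw [finsum_eq_single _ (RightCosets.mk H γ)]
  · beta_reduce
    have h1 := (hm (RightCosets.mk H γ)).2 rfl
    rw [heckeChar_of_mem h1, mul_one]
    have h2 := (mem_doubleCoset_iff_of_conj_mem hγ).1 h1
    rw [← hf.2.1 _ h2]
    congr 1
    group
  · intro q hq
    beta_reduce
    rw [heckeChar_of_notMem (mt (hm q).1 hq), mul_zero]

/-- For infinite `s` both sides take their default value 0, so no finiteness is assumed. -/
theorem finsum_indicator_one {ι : Type v} (s : Set ι) :
    ∑ᶠ i, s.indicator (fun _ => (1 : ℂ)) i = s.ncard := by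
  by_cases hs : s.Finite
  · rw [finsum_eq_sum_of_support_subset (s := hs.toFinset)]
    · rw [Set.ncard_eq_toFinset_card s hs, Finset.card_eq_sum_ones, Nat.cast_sum]
      refine Finset.sum_congr rfl fun i hi => ?_
      rw [Set.indicator_of_mem (hs.mem_toFinset.1 hi), Nat.cast_one]
    · rw [hs.coe_toFinset]
      exact Set.support_indicator_subset
  · rw [Set.Infinite.ncard hs, Nat.cast_zero]
    refine finsum_of_infinite_support ?_
    rw [Set.support_indicator, Function.support_const one_ne_zero, Set.inter_univ]
    exact hs

/-- The right cosets that contribute to the coefficient of `k` in `[a] * [b]`. -/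
def structureSet (H : Subgroup Γ) (a b k : Γ) : Set (RightCosets H) :=
  {q | k * q.out⁻¹ ∈ DoubleCoset.doubleCoset a (H : Set Γ) H ∧
    q.out ∈ DoubleCoset.doubleCoset b (H : Set Γ) H}

theorem heckeConv_char_char (a b k : Γ) :
    heckeConv H (heckeChar H a) (heckeChar H b) k = (structureSet H a b k).ncard := by
  classical
  rw [← finsum_indicator_one]
  unfold heckeConv cosetSum heckeChar structureSet
  refine finsum_congr fun q => ?_
  simp only [Set.indicator_apply, Set.mem_ofPred_eq, ite_and]
  split_ifs <;> simp

theorem structureSet_subset (a b k : Γ) :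
    structureSet H a b k ⊆ RightCosets.mk H '' DoubleCoset.doubleCoset b H H :=
  fun q hq => ⟨q.out, hq.2, RightCosets.mk_out q⟩

/-- The Hecke condition matters here: `ncard` of an infinite set would be 0. -/
theorem heckeR_ne_zero (hH : IsHeckePair H) (γ : Γ) : heckeR H γ ≠ 0 := by
  refine Set.ncard_ne_zero_of_mem (a := RightCosets.mk H γ) ?_ (finite_rightCosets hH γ)
  exact ⟨γ, DoubleCoset.mem_doubleCoset_self H H γ, rfl⟩

theorem inv_conj_mem {γ : Γ} (hγ : ∀ h ∈ H, γ⁻¹ * h * γ ∈ H) : ∀ h ∈ H, γ⁻¹ * h * γ⁻¹⁻¹ ∈ H := by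
  simpa using hγ

theorem mem_doubleCoset_iff_of_inv_conj_mem {γ : Γ} (hγ : ∀ h ∈ H, γ⁻¹ * h * γ ∈ H) {k : Γ} :
    k ∈ DoubleCoset.doubleCoset γ (H : Set Γ) H ↔ γ⁻¹ * k ∈ H := by
  conv_lhs => rw [← inv_inv k, inv_mem_doubleCoset_inv]
  rw [mem_doubleCoset_iff_of_conj_mem (inv_conj_mem hγ), ← H.inv_mem_iff]
  simp

/-- The factorization k = (kq⁻¹)q has its first factor in Ha⁻¹ and its second in bH. Therefore
[a⁻¹][b] is supported in one double coset. -/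
theorem mem_of_mul_mem_doubleCoset {a b k q : Γ} (ha : ∀ h ∈ H, a⁻¹ * h * a ∈ H)
    (hb : ∀ h ∈ H, b⁻¹ * h * b ∈ H)
    (h1 : k * q⁻¹ ∈ DoubleCoset.doubleCoset a⁻¹ (H : Set Γ) H)
    (h2 : q ∈ DoubleCoset.doubleCoset b (H : Set Γ) H) :
    k ∈ DoubleCoset.doubleCoset (a⁻¹ * b) (H : Set Γ) H := by
  rw [mem_doubleCoset_iff_of_conj_mem (inv_conj_mem ha)] at h1
  rw [mem_doubleCoset_iff_of_inv_conj_mem hb] at h2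
  rw [DoubleCoset.mem_doubleCoset]
  exact ⟨_, h1, _, h2, by group⟩

/-! ### Multiplication rules for characteristic functions, and their linear span -/

namespace HeckeAlgebra

variable (hH : IsHeckePair H)

theorem mul_val (f g : HeckeAlgebra hH) : (f * g).1 = heckeConv H f.1 g.1 := rfl

theorem star_val (f : HeckeAlgebra hH) (k : Γ) : (star f).1 k = conj (f.1 k⁻¹) := rfl

theorem add_val (f g : HeckeAlgebra hH) (k : Γ) : (f + g).1 k = f.1 k + g.1 k := rfl

theorem smul_val (c : ℂ) (f : HeckeAlgebra hH) (k : Γ) : (c • f).1 k = c * f.1 k := rfl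

theorem char_val (γ : Γ) : (char hH γ).1 = heckeChar H γ := rfl

theorem char_one : char hH 1 = 1 := rfl

theorem char_congr {γ k : Γ} (h : k ∈ DoubleCoset.doubleCoset γ (H : Set Γ) H) :
    char hH k = char hH γ := Subtype.ext (heckeChar_congr h)

theorem star_char (γ : Γ) : star (char hH γ) = char hH γ⁻¹ := by
  refine Subtype.ext (funext fun k => ?_)
  rw [star_val, char_val, char_val]
  by_cases hk : k ∈ DoubleCoset.doubleCoset γ⁻¹ (H : Set Γ) H
  · rw [heckeChar_of_mem hk, heckeChar_of_mem (inv_mem_doubleCoset_inv.2 hk), map_one]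
  · rw [heckeChar_of_notMem hk, heckeChar_of_notMem (mt inv_mem_doubleCoset_inv.1 hk), map_zero]

theorem mul_char_val (f : HeckeAlgebra hH) {γ : Γ} (hγ : ∀ h ∈ H, γ * h * γ⁻¹ ∈ H) (k : Γ) :
    (f * char hH γ).1 k = f.1 (k * γ⁻¹) := heckeConv_char_right f.2 hγ k

/-- The convolution sums over right cosets, whereas HγH is here a single left coset. Taking adjoints
reduces to right multiplication by [γ⁻¹], where the sum has one term. -/
theorem char_mul_val (f : HeckeAlgebra hH) {γ : Γ} (hγ : ∀ h ∈ H, γ⁻¹ * h * γ ∈ H) (k : Γ) :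
    (char hH γ * f).1 k = f.1 (γ⁻¹ * k) := by
  have h : char hH γ * f = star (star f * char hH γ⁻¹) := by
    rw [star_mul, star_star, star_char, inv_inv]
  rw [h, star_val, mul_char_val hH _ (inv_conj_mem hγ), star_val]
  simp

theorem char_mul_char {a b : Γ} (ha : ∀ h ∈ H, a⁻¹ * h * a ∈ H) (hb : ∀ h ∈ H, b⁻¹ * h * b ∈ H) :
    char hH a * char hH b = char hH (a * b) := by
  classical
  have hab : ∀ h ∈ H, (a * b)⁻¹ * h * (a * b) ∈ H := by
    intro h hh
    simpa [mul_assoc] using hb _ (ha h hh)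
  refine Subtype.ext (funext fun k => ?_)
  rw [char_mul_val hH _ ha, char_val, char_val]
  have : a⁻¹ * k ∈ DoubleCoset.doubleCoset b (H : Set Γ) H ↔
      k ∈ DoubleCoset.doubleCoset (a * b) (H : Set Γ) H := by
    rw [mem_doubleCoset_iff_of_inv_conj_mem hb, mem_doubleCoset_iff_of_inv_conj_mem hab]
    simp [mul_assoc]
  simp only [heckeChar, Set.indicator_apply, this]

/-- The product is supported in Hγ⁻¹γH = H, and at a point of `H` every right coset contained in HγH
contributes 1. -/
theorem char_inv_mul_char_self {γ : Γ} (hγ : ∀ h ∈ H, γ⁻¹ * h * γ ∈ H) :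
    char hH γ⁻¹ * char hH γ = (heckeR H γ : ℂ) • 1 := by
  refine Subtype.ext (funext fun k => ?_)
  rw [mul_val, char_val, char_val, heckeConv_char_char, smul_val]
  rw [← char_one, char_val]
  by_cases hk : k ∈ DoubleCoset.doubleCoset 1 (H : Set Γ) H
  · have hk' : k ∈ H := by simpa [mem_doubleCoset_iff_of_conj_mem (H := H) (γ := 1)] using hk
    rw [heckeChar_of_mem hk, mul_one, heckeR]
    congr 2
    refine (structureSet_subset _ _ _).antisymm ?_
    rintro _ ⟨x, hx, rfl⟩
    have hx' : (RightCosets.mk H x).out ∈ DoubleCoset.doubleCoset γ (H : Set Γ) H := by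
      have h1 := (RightCosets.mk_eq_iff H).1 (RightCosets.mk_out (RightCosets.mk H x))
      rw [DoubleCoset.mem_doubleCoset] at hx ⊢
      obtain ⟨a, ha, b, hb, hab⟩ := hx
      refine ⟨(x * (RightCosets.mk H x).out⁻¹)⁻¹ * a, H.mul_mem (H.inv_mem h1) ha, b, hb, ?_⟩
      rw [mul_assoc _ a, mul_assoc _ (a * γ), ← hab]
      group
    refine ⟨?_, hx'⟩
    rw [mem_doubleCoset_iff_of_conj_mem (inv_conj_mem hγ)]
    rw [mem_doubleCoset_iff_of_inv_conj_mem hγ] at hx'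
    simpa [mul_assoc] using H.mul_mem hk' (H.inv_mem hx')
  · rw [heckeChar_of_notMem hk, mul_zero]
    have : structureSet H γ⁻¹ γ k = ∅ := by
      refine Set.eq_empty_of_forall_notMem fun q hq => hk ?_
      simpa using mem_of_mul_mem_doubleCoset hγ hγ hq.1 hq.2
    rw [this, Set.ncard_empty, Nat.cast_zero]

/-- A biinvariant function supported in one double coset is a multiple of its characteristic
function. The multiple is nonzero because the right coset Hb contributes to the value at a⁻¹b; its
exact value is never needed. -/
theorem exists_char_inv_mul_char {a b : Γ} (ha : ∀ h ∈ H, a⁻¹ * h * a ∈ H)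
    (hb : ∀ h ∈ H, b⁻¹ * h * b ∈ H) :
    ∃ c : ℂ, c ≠ 0 ∧ char hH a⁻¹ * char hH b = c • char hH (a⁻¹ * b) := by
  have hval : ∀ k, (char hH a⁻¹ * char hH b).1 k = (structureSet H a⁻¹ b k).ncard := fun k =>
    heckeConv_char_char _ _ k
  refine ⟨(structureSet H a⁻¹ b (a⁻¹ * b)).ncard, ?_, ?_⟩
  · rw [Nat.cast_ne_zero]
    refine Set.ncard_ne_zero_of_mem (a := RightCosets.mk H b) ?_
      ((finite_rightCosets hH b).subset (structureSet_subset _ _ _))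
    have h1 := (RightCosets.mk_eq_iff H).1 (RightCosets.mk_out (RightCosets.mk H b))
    constructor
    · rw [mem_doubleCoset_iff_of_conj_mem (inv_conj_mem ha)]
      simpa [mul_assoc] using ha _ h1
    · rw [mem_doubleCoset_iff_of_inv_conj_mem hb]
      simpa [mul_assoc] using hb _ (H.inv_mem h1)
  · refine Subtype.ext (funext fun k => ?_)
    rw [smul_val, char_val, ← hval]
    by_cases hk : k ∈ DoubleCoset.doubleCoset (a⁻¹ * b) (H : Set Γ) H
    · rw [heckeChar_of_mem hk, mul_one]
      rw [DoubleCoset.mem_doubleCoset] at hk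
      obtain ⟨x, hx, y, hy, rfl⟩ := hk
      have h := (char hH a⁻¹ * char hH b).2
      rw [h.2.1 y hy, h.1 x hx]
    · rw [heckeChar_of_notMem hk, mul_zero, hval]
      have : structureSet H a⁻¹ b k = ∅ :=
        Set.eq_empty_of_forall_notMem fun q hq => hk (mem_of_mul_mem_doubleCoset ha hb hq.1 hq.2)
      rw [this, Set.ncard_empty, Nat.cast_zero]

theorem val_out (f : HeckeAlgebra hH) (k : Γ) : f.1 (DoubleCoset.mk H H k).out = f.1 k := by
  obtain ⟨a, b, ha, hb, hab⟩ := DoubleCoset.mk_out_eq_mul H H k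
  rw [hab, f.2.2.1 b hb, f.2.1 a ha]

/-- This Kronecker delta form serves twice: for the spanning property below, and for isolating
coefficients in the injectivity proof. -/
theorem heckeChar_out (d : DoubleCoset.Quotient (H : Set Γ) H) (k : Γ)
    [Decidable (DoubleCoset.mk H H k = d)] :
    heckeChar H d.out k = if DoubleCoset.mk H H k = d then 1 else 0 := by
  have : k ∈ DoubleCoset.doubleCoset d.out (H : Set Γ) H ↔ DoubleCoset.mk H H k = d := by
    conv_rhs => rw [← DoubleCoset.out_eq' H H d, eq_comm, DoubleCoset.eq]
    exact DoubleCoset.mem_doubleCoset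
  split_ifs with h
  · exact heckeChar_of_mem (this.2 h)
  · exact heckeChar_of_notMem (mt this.1 h)

theorem span_range_char : Submodule.span ℂ (Set.range (char hH)) = ⊤ := by
  classical
  rw [eq_top_iff]
  rintro f -
  have hf := f.2.2.2
  have : f = ∑ d ∈ hf.toFinset, f.1 d.out • char hH d.out := by
    refine Subtype.ext (funext fun k => ?_)
    have hsum : ∀ s : Finset (DoubleCoset.Quotient (H : Set Γ) H),
        (∑ d ∈ s, f.1 d.out • char hH d.out).1 k =
          ∑ d ∈ s, if DoubleCoset.mk H H k = d then f.1 d.out else 0 := by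
      intro s
      induction s using Finset.induction_on with
      | empty => rfl
      | insert d s hd ih =>
        rw [Finset.sum_insert hd, Finset.sum_insert hd, add_val, ih, smul_val, char_val,
          heckeChar_out, mul_ite, mul_one, mul_zero]
    rw [hsum, Finset.sum_ite_eq, val_out]
    split_ifs with h
    · rfl
    · by_contra h0
      exact h (hf.mem_toFinset.2 ⟨k, h0, rfl⟩)
  rw [this]
  exact Submodule.sum_mem _ fun d _ =>
    Submodule.smul_mem _ _ (Submodule.subset_span ⟨_, rfl⟩)

end HeckeAlgebra

end HeckeProducts

/-! ### The universal property of the crossed product -/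

namespace CrossedProduct

section Lift

variable {A : Type u} [Ring A] [StarRing A] [Algebra ℂ A] [StarModule ℂ A]
  {S : Type v} [Semigroup S] {α : S →ₙ* (A →⋆ₙₐ[ℂ] A)}
  {B : Type w} [Ring B] [StarRing B] [Algebra ℂ B] [StarModule ℂ B]

/-- The values on generators of the homomorphism determined by a covariant pair. -/
def liftGen (f : A →⋆ₐ[ℂ] B) (V : S → B) : CrossedProductGen A S → B
  | .elt a => f a
  | .iso s => V s
  | .coiso s => star (V s)

/-- The *-homomorphism of `A ⋊_α S` determined by a covariant pair. -/
def lift (f : A →⋆ₐ[ℂ] B) (V : S → B) (hV : ∀ s t, V (s * t) = V s * V t)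
    (hi : ∀ s, star (V s) * V s = 1) (hc : ∀ s a, V s * f a * star (V s) = f (α s a)) :
    CrossedProduct α →⋆ₐ[ℂ] B :=
  let F : CrossedProduct α →ₐ[ℂ] B :=
    RingQuot.liftAlgHom ℂ (s := CrossedProductRel α) ⟨FreeAlgebra.lift ℂ (liftGen f V), by
      intro x y h
      cases h with
      | add a b => simp [liftGen]
      | mul a b => simp [liftGen]
      | scalar c => simp [liftGen, AlgHomClass.commutes]
      | iso_mul s t => simp [liftGen, hV]
      | coiso_mul s t => simp [liftGen, hV]
      | isometry s => simp [liftGen, hi]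
      | covariance s a => simp [liftGen, hc]⟩
  have hF : ∀ g, F (gen α g) = liftGen f V g := fun g =>
    (RingQuot.liftAlgHom_mkAlgHom_apply ℂ (s := CrossedProductRel α) _ _
      (FreeAlgebra.ι ℂ g)).trans (FreeAlgebra.lift_ι_apply _ _)
  { F with
    map_star' := fun x => by
      change F (star x) = star (F x)
      induction x using induction with
      | hs c =>
        rw [star_algebraMap, AlgHom.commutes, AlgHom.commutes]
        exact algebraMap_star_comm c
      | hg g =>
        rw [star_gen, hF, hF]
        cases g <;> simp [liftGen, starGen, map_star]
      | hm x y hx hy => rw [star_mul, map_mul, map_mul, star_mul, hx, hy]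
      | ha x y hx hy => rw [star_add, map_add, map_add, star_add, hx, hy] }

variable (f : A →⋆ₐ[ℂ] B) (V : S → B) (hV : ∀ s t, V (s * t) = V s * V t)
    (hi : ∀ s, star (V s) * V s = 1) (hc : ∀ s a, V s * f a * star (V s) = f (α s a))

theorem lift_gen (g : CrossedProductGen A S) :
    lift f V hV hi hc (gen α g) = liftGen f V g :=
  (RingQuot.liftAlgHom_mkAlgHom_apply ℂ (s := CrossedProductRel α) _ _
    (FreeAlgebra.ι ℂ g)).trans (FreeAlgebra.lift_ι_apply _ _)

theorem lift_coeff (a : A) : lift f V hV hi hc (coeff α a) = f a := lift_gen f V hV hi hc _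

theorem lift_isom (s : S) : lift f V hV hi hc (isom α s) = V s := lift_gen f V hV hi hc _

omit [StarModule ℂ A] in
theorem isom_mul (s t : S) : isom α (s * t) = isom α s * isom α t := by
  simpa [gen, isom] using mk_rel α (.iso_mul s t)

theorem isom_mul_coeff_mul_star (s : S) (a : A) :
    isom α s * coeff α a * star (isom α s) = coeff α (α s a) := by
  rw [star_isom]
  simpa [gen, isom, coeff] using mk_rel α (.covariance s a)

/-- Covariance multiplied on the right by v_s. This moves coefficients past isometries. -/
theorem isom_mul_coeff (s : S) (a : A) :
    isom α s * coeff α a = coeff α (α s a) * isom α s := by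
  rw [← isom_mul_coeff_mul_star, mul_assoc _ (star _), star_isom_mul_self, mul_one]

theorem isom_mul_star_isom (s : S) : isom α s * star (isom α s) = coeff α (α s 1) := by
  rw [← isom_mul_coeff_mul_star, map_one, mul_one]

/-- A *-subalgebra that contains the coefficients and the isometries is everything. -/
theorem mem_of_generators {B : StarSubalgebra ℂ (CrossedProduct α)}
    (h1 : ∀ a, coeff α a ∈ B) (h2 : ∀ s, isom α s ∈ B) (x : CrossedProduct α) : x ∈ B := by
  induction x using induction with
  | hs c => exact B.algebraMap_mem c
  | hg g =>
    cases g with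
    | elt a => exact h1 a
    | iso s => exact h2 s
    | coiso s => rw [← star_isom]; exact star_mem (h2 s)
  | hm x y hx hy => exact mul_mem hx hy
  | ha x y hx hy => exact add_mem hx hy

end Lift

/-! ### Monomials in the crossed product of a group algebra -/

section Monomials

variable {N G : Type u} [Group N] [Group G] {φ : G →* MulAut N}
  {Γ₀ : Subgroup N} [Γ₀.Normal] {S : Subsemigroup G}
  (α : S →ₙ* (MonoidAlgebra ℂ (N ⧸ Γ₀) →⋆ₙₐ[ℂ] MonoidAlgebra ℂ (N ⧸ Γ₀)))

/-- The image of `x ∈ N` in the crossed product. -/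
def unitary : N →* CrossedProduct α :=
  ((coeff α : MonoidAlgebra ℂ (N ⧸ Γ₀) →* CrossedProduct α).comp
    (MonoidAlgebra.of ℂ (N ⧸ Γ₀))).comp (QuotientGroup.mk' Γ₀)

theorem unitary_apply (x : N) :
    unitary α x = coeff α (MonoidAlgebra.of ℂ (N ⧸ Γ₀) (x : N ⧸ Γ₀)) := rfl

theorem unitary_of_mem {x : N} (hx : x ∈ Γ₀) : unitary α x = 1 := by
  rw [unitary_apply, (QuotientGroup.eq_one_iff x).2 hx, map_one, map_one]

theorem star_unitary (x : N) : star (unitary α x) = unitary α x⁻¹ := by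
  rw [unitary_apply, unitary_apply, ← map_star, MonoidAlgebra.of_apply,
    MonoidAlgebra.star_single_complex, map_one, MonoidAlgebra.of_apply]
  rfl

/-- The monomial `v_t* e(x) v_s`. -/
def monomial (t : S) (x : N) (s : S) : CrossedProduct α :=
  star (isom α t) * unitary α x * isom α s

variable {α}
variable (hα : ∀ (s : S) (x : N), α s (MonoidAlgebra.of ℂ (N ⧸ Γ₀) (x : N ⧸ Γ₀)) =
  MonoidAlgebra.of ℂ (N ⧸ Γ₀) ((φ (s : G) x : N) : N ⧸ Γ₀) * α s 1)

include hα

/-- Although α_s(e(x)) is an average, it equals e(sxs⁻¹) times the projection α_s(1) = v_s v_s*,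
which v_s absorbs. -/
theorem isom_mul_unitary (s : S) (x : N) :
    isom α s * unitary α x = unitary α (φ (s : G) x) * isom α s := by
  rw [unitary_apply, isom_mul_coeff, hα, map_mul, mul_assoc, ← isom_mul_coeff, map_one, mul_one]
  rfl

theorem unitary_mul_star_isom (s : S) (x : N) :
    unitary α x * star (isom α s) = star (isom α s) * unitary α (φ (s : G) x) := by
  have h := congrArg star (isom_mul_unitary hα s x⁻¹)
  simpa [star_unitary] using h

/-- The counterpart of t⁻¹xs = (pt)⁻¹(pxp⁻¹)(ps) in Γ; it holds because v_p* e(pxp⁻¹) v_p = e(x). It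
serves to bring two monomials to a common denominator. -/
theorem monomial_mul_left (p t : S) (x : N) (s : S) :
    monomial α (p * t) (φ (p : G) x) (p * s) = monomial α t x s := by
  unfold monomial
  rw [isom_mul, isom_mul, star_mul]
  calc star (isom α t) * star (isom α p) * unitary α (φ (p : G) x) * (isom α p * isom α s)
      = star (isom α t) * (star (isom α p) * (unitary α (φ (p : G) x) * isom α p)) *
          isom α s := by simp only [mul_assoc]
    _ = star (isom α t) * unitary α x * isom α s := by
      rw [← isom_mul_unitary hα, ← mul_assoc (star (isom α p)), star_isom_mul_self, one_mul]

/-- In Γ this multiplies t⁻¹xs on the right by h. In the crossed product e(shs⁻¹)v_s = v_s e(h) =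
v_s. The next lemma is the left-hand version. -/
theorem monomial_mul_of_mem (t : S) (x : N) (s : S) {h : N} (hh : h ∈ Γ₀) :
    monomial α t (x * φ (s : G) h) s = monomial α t x s := by
  unfold monomial
  rw [map_mul, ← mul_assoc, mul_assoc _ (unitary α (φ (s : G) h)), ← isom_mul_unitary hα,
    unitary_of_mem α hh, mul_one]

theorem monomial_of_mem_mul (t : S) (x : N) (s : S) {h : N} (hh : h ∈ Γ₀) :
    monomial α t (φ (t : G) h * x) s = monomial α t x s := by
  unfold monomial
  rw [map_mul, ← mul_assoc, ← unitary_mul_star_isom hα, unitary_of_mem α hh, one_mul]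

/-! ### The Ore condition: monomials indexed by double cosets, and their span -/

variable (hS : (S : Set G)⁻¹ * (S : Set G) = Set.univ)

include hS

omit hα in
theorem exists_inv_mul_eq (g : G) : ∃ p q : S, (p : G)⁻¹ * q = g := by
  have h : g ∈ (S : Set G)⁻¹ * (S : Set G) := hS ▸ Set.mem_univ g
  obtain ⟨p, hp, q, hq, rfl⟩ := Set.mem_mul.1 h
  exact ⟨⟨p⁻¹, hp⟩, ⟨q, hq⟩, by simp⟩

omit hα in
-- Write st⁻¹ as p⁻¹q.
theorem exists_mul_eq_mul (s t : S) : ∃ p q : S, p * s = q * t := by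
  obtain ⟨p, q, h⟩ := exists_inv_mul_eq hS ((s : G) * (t : G)⁻¹)
  refine ⟨p, q, Subtype.ext ?_⟩
  rw [inv_mul_eq_iff_eq_mul] at h
  change (p : G) * s = q * t
  rw [h]
  group

/-- Choose p, q with pt = qt'. Equality of the `G`-components forces ps = qs' as well, so both
monomials can be rewritten with the same outer isometries. The `N`-components then differ by
conjugates of elements of Γ₀, which the isometries absorb. -/
theorem monomial_eq_of_mem_doubleCoset (t : S) (x : N) (s t' : S) (x' : N) (s' : S)
    (h : (SemidirectProduct.inr (t : G)⁻¹ * SemidirectProduct.inl x *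
        SemidirectProduct.inr (s : G) : N ⋊[φ] G) ∈
      DoubleCoset.doubleCoset (SemidirectProduct.inr (t' : G)⁻¹ * SemidirectProduct.inl x' *
        SemidirectProduct.inr (s' : G) : N ⋊[φ] G)
        (Γ₀.map (SemidirectProduct.inl : N →* N ⋊[φ] G) : Set (N ⋊[φ] G))
        (Γ₀.map (SemidirectProduct.inl : N →* N ⋊[φ] G))) :
    monomial α t x s = monomial α t' x' s' := by
  rw [DoubleCoset.mem_doubleCoset] at h
  obtain ⟨_, ⟨a, ha, rfl⟩, _, ⟨b, hb, rfl⟩, h⟩ := h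
  obtain ⟨p, q, hpq⟩ := exists_mul_eq_mul hS t t'
  have hR := congrArg SemidirectProduct.right h
  have hL := congrArg SemidirectProduct.left h
  simp at hR hL
  have hpq' : (p : G) * t = q * t' := congrArg Subtype.val hpq
  have hqt : (q : G) = p * t * (t' : G)⁻¹ := by rw [hpq']; group
  -- The `G`-component of the double coset relation is t⁻¹s = t'⁻¹s'.
  have hps : p * s = q * s' := by
    refine Subtype.ext ?_
    change (p : G) * s = q * s'
    rw [hqt]
    have : (s : G) = t * ((t' : G)⁻¹ * s') := by rw [← hR]; group
    rw [this]
    group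
  rw [← monomial_mul_left hα p t x s, ← monomial_mul_left hα q t' x' s', hpq, hps]
  -- The left component, solved for x and conjugated by p, with pt replaced by qt'.
  have hx : φ (p : G) x = φ ((q * t' : S) : G) a * (φ (q : G) x' * φ ((q * s' : S) : G) b) := by
    have hx : x = φ (t : G) (a * (φ (t' : G)).symm x' * (φ (t' : G)).symm (φ (s' : G) b)) := by
      rw [← hL, MulEquiv.apply_symm_apply]
    have hφ : ∀ y, φ (p : G) (φ (t : G) y) = φ (q : G) (φ (t' : G) y) := fun y => by
      rw [← MulAut.mul_apply, ← MulAut.mul_apply, ← map_mul, ← map_mul, hpq']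
    rw [hx, hφ]
    simp [mul_assoc]
  rw [hx, monomial_of_mem_mul hα _ _ _ ha, monomial_mul_of_mem hα _ _ _ hb]

omit hα hS in
theorem linearMap_mem_of_forall_of_mem (f : MonoidAlgebra ℂ (N ⧸ Γ₀) →ₗ[ℂ] CrossedProduct α)
    (W : Submodule ℂ (CrossedProduct α))
    (h : ∀ x : N, f (MonoidAlgebra.of ℂ (N ⧸ Γ₀) (x : N ⧸ Γ₀)) ∈ W)
    (a : MonoidAlgebra ℂ (N ⧸ Γ₀)) : f a ∈ W := by
  induction a using MonoidAlgebra.induction_on with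
  | of g =>
    obtain ⟨x, rfl⟩ := QuotientGroup.mk_surjective g
    exact h x
  | add f g hf hg => rw [map_add]; exact W.add_mem hf hg
  | smul c f hf => rw [map_smul]; exact W.smul_mem c hf

variable (α) in
/-- The span of the monomials. -/
def monomialSpan : Submodule ℂ (CrossedProduct α) :=
  Submodule.span ℂ (Set.range fun i : S × N × S => monomial α i.1 i.2.1 i.2.2)

omit hα hS in
theorem monomial_mem (t : S) (x : N) (s : S) : monomial α t x s ∈ monomialSpan α :=
  Submodule.subset_span ⟨(t, x, s), rfl⟩

omit hα hS in
theorem star_isom_mul_coeff_mul_isom_mem (t : S) (a : MonoidAlgebra ℂ (N ⧸ Γ₀)) (s : S) :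
    star (isom α t) * coeff α a * isom α s ∈ monomialSpan α :=
  linearMap_mem_of_forall_of_mem ((LinearMap.mulRight ℂ (isom α s)).comp
    ((LinearMap.mulLeft ℂ (star (isom α t))).comp (coeff α).toAlgHom.toLinearMap)) _
    (fun x => monomial_mem t x s) a

/-- The inner factor v_s v_{t'}* has its star on the wrong side. If ps = qt', it equals v_p* v_q
α_{t'}(1): insert v_p* v_p = 1 and use v_p v_s = v_q v_{t'}. All coefficients can then be collected
between v_{pt}* and v_{qs'}. -/
theorem monomial_mul_monomial_mem (t : S) (x : N) (s t' : S) (x' : N) (s' : S) :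
    monomial α t x s * monomial α t' x' s' ∈ monomialSpan α := by
  obtain ⟨p, q, hpq⟩ := exists_mul_eq_mul hS s t'
  have h1 : isom α s * star (isom α t') =
      star (isom α p) * isom α q * coeff α (α t' 1) := by
    rw [← isom_mul_star_isom, ← mul_assoc, mul_assoc (star _), ← isom_mul, ← hpq, isom_mul,
      ← mul_assoc (star _), star_isom_mul_self, one_mul]
  have h2 : monomial α t x s * monomial α t' x' s' =
      star (isom α (p * t)) * coeff α (MonoidAlgebra.of ℂ (N ⧸ Γ₀) ((φ (p : G) x : N) : N ⧸ Γ₀) *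
        α q (α t' 1 * MonoidAlgebra.of ℂ (N ⧸ Γ₀) (x' : N ⧸ Γ₀))) * isom α (q * s') := by
    unfold monomial
    calc star (isom α t) * unitary α x * isom α s *
          (star (isom α t') * unitary α x' * isom α s')
        = star (isom α t) * unitary α x * (isom α s * star (isom α t')) *
          (unitary α x' * isom α s') := by simp only [mul_assoc]
      _ = star (isom α t) * (unitary α x * star (isom α p)) * (isom α q *
          coeff α (α t' 1 * MonoidAlgebra.of ℂ (N ⧸ Γ₀) (x' : N ⧸ Γ₀))) * isom α s' := by
        rw [h1, map_mul (coeff α), ← unitary_apply]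
        simp only [mul_assoc]
      _ = _ := by
        rw [unitary_mul_star_isom hα, isom_mul_coeff, unitary_apply, isom_mul, isom_mul, star_mul,
          map_mul (coeff α)]
        simp only [mul_assoc]
  rw [h2]
  exact star_isom_mul_coeff_mul_isom_mem _ _ _

theorem monomialSpan_mul_mem {a b : CrossedProduct α} (ha : a ∈ monomialSpan α)
    (hb : b ∈ monomialSpan α) : a * b ∈ monomialSpan α := by
  induction ha, hb using Submodule.span_induction₂ with
  | mem_mem x y hx hy =>
    obtain ⟨⟨t, x, s⟩, rfl⟩ := hx
    obtain ⟨⟨t', x', s'⟩, rfl⟩ := hy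
    exact monomial_mul_monomial_mem hα hS t x s t' x' s'
  | zero_left y hy => rw [zero_mul]; exact Submodule.zero_mem _
  | zero_right x hx => rw [mul_zero]; exact Submodule.zero_mem _
  | add_left x y z _ _ _ h1 h2 => rw [add_mul]; exact Submodule.add_mem _ h1 h2
  | add_right x y z _ _ _ h1 h2 => rw [mul_add]; exact Submodule.add_mem _ h1 h2
  | smul_left r x y _ _ h => rw [smul_mul_assoc]; exact Submodule.smul_mem _ r h
  | smul_right r x y _ _ h => rw [mul_smul_comm]; exact Submodule.smul_mem _ r h

/-- As `S` need not contain 1, the generators must be padded to monomials: a = v_s* α_s(a) v_s, v_s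
= v_s* v_{ss} and v_s* = v_{ss}* v_s. -/
theorem mem_monomialSpan (x : CrossedProduct α) : x ∈ monomialSpan α := by
  -- Only used to see that `S` is nonempty.
  obtain ⟨s, -, -⟩ := exists_inv_mul_eq hS 1
  have hcoeff : ∀ a, coeff α a ∈ monomialSpan α := by
    intro a
    have h : coeff α a = star (isom α s) * coeff α (α s a) * isom α s := by
      rw [mul_assoc, ← isom_mul_coeff, ← mul_assoc, star_isom_mul_self, one_mul]
    rw [h]
    exact star_isom_mul_coeff_mul_isom_mem _ _ _
  induction x using induction with
  | hs c =>
    rw [← AlgHomClass.commutes (coeff α) c]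
    exact hcoeff _
  | hg g =>
    cases g with
    | elt a => exact hcoeff a
    | iso s =>
      have h := star_isom_mul_coeff_mul_isom_mem (α := α) s 1 (s * s)
      rwa [map_one, mul_one, isom_mul, ← mul_assoc, star_isom_mul_self, one_mul] at h
    | coiso s =>
      have h := star_isom_mul_coeff_mul_isom_mem (α := α) (s * s) 1 s
      rwa [map_one, mul_one, isom_mul, star_mul, mul_assoc, star_isom_mul_self, mul_one,
        star_isom] at h
  | hm x y hx hy => exact monomialSpan_mul_mem hα hS hx hy
  | ha x y hx hy => exact Submodule.add_mem _ hx hy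

end Monomials

end CrossedProduct

/-! ### The group algebra of a normal subquotient inside a Hecke algebra -/

theorem isHeckePair_of_normal {N : Type u} [Group N] (Γ₀ : Subgroup N) [hn : Γ₀.Normal] :
    IsHeckePair Γ₀ := by
  intro x
  refine (Set.finite_singleton (x : N ⧸ Γ₀)).subset ?_
  rintro _ ⟨y, hy, rfl⟩
  rw [DoubleCoset.mem_doubleCoset] at hy
  obtain ⟨a, ha, b, hb, rfl⟩ := hy
  refine (QuotientGroup.eq.2 ?_).symm
  have := Γ₀.mul_mem (hn.conj_mem a ha x⁻¹) hb
  simpa [mul_assoc] using this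

namespace HeckeAlgebra

section OfGroupAlgebra

variable {N : Type u} {Γ : Type v} [Group N] [Group Γ] {Γ₀ : Subgroup N} [hn : Γ₀.Normal]
  {H : Subgroup Γ} (hH : IsHeckePair H) (ι : N →* Γ) (hι : Γ₀.map ι = H)

include hι

omit hH in
-- Normality of Γ₀ in `N` is enough, although `H` need not be normal in Γ. The map ι stays general
-- because it is used both as the identity of `N` and as the inclusion of `N` in the semidirect
-- product.
theorem inv_mul_mul_mem_of_map_eq (x : N) : ∀ h ∈ H, (ι x)⁻¹ * h * ι x ∈ H := by
  subst hι
  rintro _ ⟨h, hh, rfl⟩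
  refine ⟨x⁻¹ * h * x, ?_, by simp⟩
  simpa using hn.conj_mem h hh x⁻¹

omit hH hn in
theorem map_mem_iff_of_map_eq (hinj : Function.Injective ι) {x : N} : ι x ∈ H ↔ x ∈ Γ₀ := by
  subst hι
  exact Subgroup.mem_map_iff_mem hinj

/-- The map `x ↦ [ι(x)]` as a homomorphism to the Hecke algebra. -/
def charHom : N →* HeckeAlgebra hH where
  toFun x := char hH (ι x)
  map_one' := by rw [map_one, char_one]
  map_mul' x y := by
    rw [char_mul_char hH (inv_mul_mul_mem_of_map_eq ι hι x) (inv_mul_mul_mem_of_map_eq ι hι y),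
      map_mul]

theorem charHom_of_mem : Γ₀ ≤ (charHom hH ι hι).ker := by
  intro x hx
  have h : ι x ∈ H := hι ▸ Subgroup.mem_map_of_mem ι hx
  refine (char_congr hH (γ := 1) ?_).trans (char_one hH)
  rw [DoubleCoset.mem_doubleCoset]
  exact ⟨ι x, h, 1, H.one_mem, by simp⟩

/-- The *-homomorphism `ℂ(N/Γ₀) → 𝓗(Γ, H)` with `xΓ₀ ↦ [ι(x)]`. -/
def ofGroupAlgebra : MonoidAlgebra ℂ (N ⧸ Γ₀) →⋆ₐ[ℂ] HeckeAlgebra hH :=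
  { MonoidAlgebra.lift ℂ (HeckeAlgebra hH) (N ⧸ Γ₀)
      (QuotientGroup.lift Γ₀ (charHom hH ι hι) (charHom_of_mem hH ι hι)) with
    map_star' := fun a => by
      change MonoidAlgebra.lift ℂ (HeckeAlgebra hH) (N ⧸ Γ₀) _ (star a) =
        star (MonoidAlgebra.lift ℂ (HeckeAlgebra hH) (N ⧸ Γ₀) _ a)
      induction a using MonoidAlgebra.induction_linear with
      | zero => rw [star_zero, map_zero, star_zero]
      | add f g hf hg => rw [star_add, map_add, map_add, star_add, hf, hg]
      | single q c =>
        obtain ⟨x, rfl⟩ := QuotientGroup.mk_surjective q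
        rw [MonoidAlgebra.star_single_complex, MonoidAlgebra.lift_single,
          MonoidAlgebra.lift_single, star_smul, ← QuotientGroup.mk_inv, QuotientGroup.lift_mk,
          QuotientGroup.lift_mk]
        refine congrArg _ ?_
        change char hH (ι x⁻¹) = star (char hH (ι x))
        rw [star_char, map_inv] }

theorem ofGroupAlgebra_single (x : N) (c : ℂ) :
    ofGroupAlgebra hH ι hι (MonoidAlgebra.single (x : N ⧸ Γ₀) c) = c • char hH (ι x) :=
  MonoidAlgebra.lift_single _ _ _

theorem ofGroupAlgebra_of (x : N) :
    ofGroupAlgebra hH ι hι (MonoidAlgebra.of ℂ (N ⧸ Γ₀) (x : N ⧸ Γ₀)) = char hH (ι x) := by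
  rw [MonoidAlgebra.of_apply, ofGroupAlgebra_single, one_smul]

variable (hinj : Function.Injective ι)

omit hH in
-- Here Hι(x)H = ι(x)H, so on `N` double cosets are the same as cosets of Γ₀.
theorem map_mem_doubleCoset_iff (hinj : Function.Injective ι) {x n : N} :
    ι n ∈ DoubleCoset.doubleCoset (ι x) (H : Set Γ) H ↔ (x : N ⧸ Γ₀) = n := by
  rw [mem_doubleCoset_iff_of_inv_conj_mem (inv_mul_mul_mem_of_map_eq ι hι x), QuotientGroup.eq,
    ← map_mem_iff_of_map_eq ι hι hinj, map_mul, map_inv]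

omit hH in
theorem heckeChar_map (hinj : Function.Injective ι) [DecidableEq (N ⧸ Γ₀)] (x n : N) :
    heckeChar H (ι x) (ι n) = if (x : N ⧸ Γ₀) = n then 1 else 0 := by
  split_ifs with h
  · exact heckeChar_of_mem ((map_mem_doubleCoset_iff ι hι hinj).2 h)
  · exact heckeChar_of_notMem (mt (map_mem_doubleCoset_iff ι hι hinj).1 h)

include hinj

theorem ofGroupAlgebra_val (a : MonoidAlgebra ℂ (N ⧸ Γ₀)) (n : N) :
    (ofGroupAlgebra hH ι hι a).1 (ι n) = a.coeff (n : N ⧸ Γ₀) := by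
  classical
  induction a using MonoidAlgebra.induction_linear with
  | zero => rw [map_zero]; rfl
  | add f g hf hg => rw [map_add, add_val, hf, hg]; rfl
  | single q c =>
    obtain ⟨x, rfl⟩ := QuotientGroup.mk_surjective q
    rw [ofGroupAlgebra_single, smul_val, char_val, heckeChar_map ι hι hinj,
      MonoidAlgebra.coeff_single, Finsupp.single_apply, mul_ite, mul_one, mul_zero]

omit hinj in
theorem ofGroupAlgebra_val_of_notMem (a : MonoidAlgebra ℂ (N ⧸ Γ₀)) {k : Γ} (hk : k ∉ ι.range) :
    (ofGroupAlgebra hH ι hι a).1 k = 0 := by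
  induction a using MonoidAlgebra.induction_linear with
  | zero => rw [map_zero]; rfl
  | add f g hf hg => rw [map_add, add_val, hf, hg, add_zero]
  | single q c =>
    obtain ⟨x, rfl⟩ := QuotientGroup.mk_surjective q
    rw [ofGroupAlgebra_single, smul_val, char_val, heckeChar_of_notMem, mul_zero]
    rw [mem_doubleCoset_iff_of_inv_conj_mem (inv_mul_mul_mem_of_map_eq ι hι x), ← hι]
    rintro ⟨y, -, hy⟩
    exact hk ⟨x * y, by rw [map_mul, hy]; group⟩

theorem ofGroupAlgebra_injective : Function.Injective (ofGroupAlgebra hH ι hι) := by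
  intro a b hab
  refine MonoidAlgebra.ext (Finsupp.ext fun q => ?_)
  obtain ⟨x, rfl⟩ := QuotientGroup.mk_surjective q
  rw [← ofGroupAlgebra_val hH ι hι hinj, ← ofGroupAlgebra_val hH ι hι hinj, hab]

/-- Distinct cosets of Γ₀ lie in distinct double cosets of `H`, and `f` lives on finitely many of
these. -/
theorem finite_support_restrict (f : HeckeAlgebra hH) :
    (Function.support fun q : N ⧸ Γ₀ => f.1 (ι q.out)).Finite := by
  refine Set.Finite.of_finite_image (f := fun q : N ⧸ Γ₀ => DoubleCoset.mk H H (ι q.out))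
    (f.2.2.2.subset ?_) ?_
  · rintro _ ⟨q, hq, rfl⟩
    exact ⟨_, hq, rfl⟩
  · intro q _ r _ h
    have h' : ι r.out ∈ DoubleCoset.doubleCoset (ι q.out) (H : Set Γ) H :=
      DoubleCoset.mem_doubleCoset.2 ((DoubleCoset.eq H H _ _).1 h)
    rw [map_mem_doubleCoset_iff ι hι hinj] at h'
    simpa using h'

/-- The restriction of a function in the Hecke algebra to `N`, as an element of `ℂ(N/Γ₀)`. -/
def restrict (f : HeckeAlgebra hH) : MonoidAlgebra ℂ (N ⧸ Γ₀) :=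
  MonoidAlgebra.ofCoeff (Finsupp.ofSupportFinite _ (finite_support_restrict hH ι hι hinj f))

theorem restrict_coeff (f : HeckeAlgebra hH) (n : N) :
    (restrict hH ι hι hinj f).coeff (n : N ⧸ Γ₀) = f.1 (ι n) := by
  change f.1 (ι (n : N ⧸ Γ₀).out) = f.1 (ι n)
  obtain ⟨h, hh⟩ := QuotientGroup.mk_out_eq_mul Γ₀ n
  rw [hh, map_mul, f.2.2.1]
  exact hι ▸ Subgroup.mem_map_of_mem ι h.2

/-- Identifies the image of ℂ(N/Γ₀) as all Hecke functions vanishing off `N`. This is the criterion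
by which v_s a v_s* is recognized as a coefficient. -/
theorem ofGroupAlgebra_restrict (f : HeckeAlgebra hH) (hf : ∀ k ∉ ι.range, f.1 k = 0) :
    ofGroupAlgebra hH ι hι (restrict hH ι hι hinj f) = f := by
  refine Subtype.ext (funext fun k => ?_)
  by_cases hk : k ∈ ι.range
  · obtain ⟨n, rfl⟩ := hk
    rw [ofGroupAlgebra_val hH ι hι hinj, restrict_coeff]
  · rw [ofGroupAlgebra_val_of_notMem hH ι hι _ hk, hf k hk]

end OfGroupAlgebra

theorem ofGroupAlgebra_bijective {N : Type u} [Group N] {Γ₀ : Subgroup N} [Γ₀.Normal]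
    (hN : IsHeckePair Γ₀) :
    Function.Bijective (ofGroupAlgebra hN (MonoidHom.id N) Γ₀.map_id) :=
  ⟨ofGroupAlgebra_injective hN _ _ fun _ _ h => h,
    fun f => ⟨_, ofGroupAlgebra_restrict hN (MonoidHom.id N) Γ₀.map_id (fun _ _ h => h) f
      fun k hk => absurd ⟨k, rfl⟩ hk⟩⟩

theorem exists_starAlgEquiv_groupAlgebra {N : Type u} [Group N] {Γ₀ : Subgroup N} [Γ₀.Normal]
    (hN : IsHeckePair Γ₀) : ∃ Ψ : HeckeAlgebra hN ≃⋆ₐ[ℂ] MonoidAlgebra ℂ (N ⧸ Γ₀),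
      ∀ x : N, Ψ (char hN x) = MonoidAlgebra.of ℂ (N ⧸ Γ₀) (x : N ⧸ Γ₀) := by
  refine ⟨(StarAlgEquiv.ofBijective _ (ofGroupAlgebra_bijective hN)).symm, fun x => ?_⟩
  rw [StarAlgEquiv.symm_apply_eq]
  exact (ofGroupAlgebra_of hN (MonoidHom.id N) Γ₀.map_id x).symm

end HeckeAlgebra

/-! ### The Hecke pair of a semidirect product -/

section Semidirect

open SemidirectProduct

variable {N G : Type u} [Group N] [Group G] {φ : G →* MulAut N}
  {Γ₀ : Subgroup N} [hn : Γ₀.Normal] {S : Subsemigroup G}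

theorem inl_inv_conj_mem (x : N) : ∀ h ∈ Γ₀.map (inl : N →* N ⋊[φ] G),
    (inl x : N ⋊[φ] G)⁻¹ * h * inl x ∈ Γ₀.map (inl : N →* N ⋊[φ] G) :=
  HeckeAlgebra.inv_mul_mul_mem_of_map_eq inl rfl x

omit hn in
theorem inr_inv_conj_mem (hinv : ∀ s ∈ S, Γ₀.map (φ s⁻¹).toMonoidHom ≤ Γ₀) (s : S) :
    ∀ h ∈ Γ₀.map (inl : N →* N ⋊[φ] G),
      (inr (s : G) : N ⋊[φ] G)⁻¹ * h * inr (s : G) ∈ Γ₀.map (inl : N →* N ⋊[φ] G) := by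
  rintro _ ⟨x, hx, rfl⟩
  refine ⟨φ (s : G)⁻¹ x, hinv s s.2 ⟨x, hx, rfl⟩, ?_⟩
  rw [inl_aut, inv_inv, map_inv]

theorem exists_eq_inr_mul_inl_mul_inr (hS : (S : Set G)⁻¹ * (S : Set G) = Set.univ)
    (k : N ⋊[φ] G) :
    ∃ (t : S) (x : N) (s : S), k = inr (t : G)⁻¹ * inl x * inr (s : G) := by
  obtain ⟨t, s, h⟩ := CrossedProduct.exists_inv_mul_eq hS k.right
  -- For n ∈ N, n·t⁻¹s = t⁻¹(tnt⁻¹)s.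
  refine ⟨t, φ (t : G) k.left, s, ?_⟩
  ext <;> simp [h]

/-- For k = t⁻¹xs, the left coset akH with a ∈ Γ₀ depends only on a modulo t⁻¹Γ₀t. Hence HkH
contains at most [Γ₀ : t⁻¹Γ₀t] left cosets. -/
theorem isHeckePair_map_inl (hS : (S : Set G)⁻¹ * (S : Set G) = Set.univ)
    (hinv : ∀ s ∈ S, Γ₀.map (φ s⁻¹).toMonoidHom ≤ Γ₀)
    (hfin : ∀ s ∈ S, (Γ₀.map (φ s⁻¹).toMonoidHom).relIndex Γ₀ ≠ 0) :
    IsHeckePair (Γ₀.map (inl : N →* N ⋊[φ] G)) := by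
  intro k
  obtain ⟨t, x, s, rfl⟩ := exists_eq_inr_mul_inl_mul_inr hS k
  have : ((Γ₀.map (φ (t : G)⁻¹).toMonoidHom).subgroupOf Γ₀).FiniteIndex := ⟨hfin t t.2⟩
  refine (Set.finite_range fun q : Γ₀ ⧸ (Γ₀.map (φ (t : G)⁻¹).toMonoidHom).subgroupOf Γ₀ =>
    ((inl (q.out : N) * (inr (t : G)⁻¹ * inl x * inr (s : G)) : N ⋊[φ] G) :
      (N ⋊[φ] G) ⧸ Γ₀.map (inl : N →* N ⋊[φ] G))).subset ?_
  rintro _ ⟨y, hy, rfl⟩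
  rw [DoubleCoset.mem_doubleCoset] at hy
  obtain ⟨_, ⟨a, ha, rfl⟩, b, hb, rfl⟩ := hy
  refine ⟨((⟨a, ha⟩ : Γ₀) : Γ₀ ⧸ (Γ₀.map (φ (t : G)⁻¹).toMonoidHom).subgroupOf Γ₀), ?_⟩
  obtain ⟨⟨c, hc⟩, h⟩ := QuotientGroup.mk_out_eq_mul
    ((Γ₀.map (φ (t : G)⁻¹).toMonoidHom).subgroupOf Γ₀) (⟨a, ha⟩ : Γ₀)
  obtain ⟨d, hd, hdc⟩ := hc
  have hdc : φ (t : G)⁻¹ d = c := hdc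
  dsimp only
  rw [h]
  refine (QuotientGroup.eq.2 ?_).symm
  -- For d ∈ Γ₀, (t⁻¹dt)·t⁻¹xs = t⁻¹xs·(s⁻¹x⁻¹dxs), and the last factor lies in `H`.
  have h1 := inr_inv_conj_mem hinv s _ (inl_inv_conj_mem (φ := φ) x (inl d) ⟨d, hd, rfl⟩)
  have h2 := Subgroup.mul_mem _ (Subgroup.inv_mem _ hb) h1
  convert h2 using 1
  rw [Subgroup.coe_mul, ← hdc, map_mul, inl_aut]
  simp only [map_inv]
  group

end Semidirect

/-! ### The isometries in the Hecke algebra -/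

namespace HeckeAlgebra

section Isometry

variable {Γ : Type u} [Group Γ] {H : Subgroup Γ} (hH : IsHeckePair H)

/-- The normalized element `R(γ)^{-1/2} [γ]`. -/
def isometry (γ : Γ) : HeckeAlgebra hH := (((√(heckeR H γ : ℝ))⁻¹ : ℝ) : ℂ) • char hH γ

theorem inv_sqrt_mul_self (n : ℕ) :
    (((√(n : ℝ))⁻¹ : ℝ) : ℂ) * (((√(n : ℝ))⁻¹ : ℝ) : ℂ) = (n : ℂ)⁻¹ := by
  rw [← Complex.ofReal_mul, ← mul_inv, Real.mul_self_sqrt (Nat.cast_nonneg n), Complex.ofReal_inv,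
    Complex.ofReal_natCast]

theorem star_isometry (γ : Γ) :
    star (isometry hH γ) = (((√(heckeR H γ : ℝ))⁻¹ : ℝ) : ℂ) • char hH γ⁻¹ := by
  rw [isometry, star_smul, star_char]
  congr 1
  exact Complex.conj_ofReal _

theorem isometry_mul_mul_star_isometry (γ : Γ) (f : HeckeAlgebra hH) :
    isometry hH γ * f * star (isometry hH γ) =
      (heckeR H γ : ℂ)⁻¹ • (char hH γ * f * char hH γ⁻¹) := by
  rw [star_isometry, isometry, smul_mul_assoc, smul_mul_assoc, mul_smul_comm, smul_smul,
    inv_sqrt_mul_self]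

/-- This is what the normalization R(γ)^{-1/2} is chosen for. -/
theorem star_isometry_mul_self {γ : Γ} (hγ : ∀ h ∈ H, γ⁻¹ * h * γ ∈ H) :
    star (isometry hH γ) * isometry hH γ = 1 := by
  rw [star_isometry, isometry, smul_mul_assoc, mul_smul_comm, smul_smul, inv_sqrt_mul_self,
    char_inv_mul_char_self hH hγ, smul_smul,
    inv_mul_cancel₀ (Nat.cast_ne_zero.2 (heckeR_ne_zero hH γ)), one_smul]

theorem smul_one_injective {c d : ℂ} (h : c • (1 : HeckeAlgebra hH) = d • 1) : c = d := by
  have h1 := congrFun (congrArg Subtype.val h) 1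
  rw [smul_val, smul_val, ← char_one, char_val, heckeChar_self, mul_one, mul_one] at h1
  exact h1

include hH in
-- Read off from the algebra instead of counting cosets: [ab]*[ab] = [b]*[a]*[a][b], and each inner
-- square is a scalar.
theorem heckeR_mul {a b : Γ} (ha : ∀ h ∈ H, a⁻¹ * h * a ∈ H) (hb : ∀ h ∈ H, b⁻¹ * h * b ∈ H) :
    heckeR H (a * b) = heckeR H a * heckeR H b := by
  have hab : ∀ h ∈ H, (a * b)⁻¹ * h * (a * b) ∈ H := by
    intro h hh
    simpa [mul_assoc] using hb _ (ha h hh)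
  have h : (heckeR H (a * b) : ℂ) • (1 : HeckeAlgebra hH) =
      ((heckeR H a * heckeR H b : ℕ) : ℂ) • 1 := by
    rw [← char_inv_mul_char_self hH hab, ← star_char, ← char_mul_char hH ha hb, star_mul,
      mul_assoc, ← mul_assoc _ (char hH a), star_char, star_char, char_inv_mul_char_self hH ha,
      smul_mul_assoc, one_mul, mul_smul_comm, char_inv_mul_char_self hH hb, smul_smul,
      Nat.cast_mul]
  exact_mod_cast smul_one_injective hH h

theorem isometry_mul {a b : Γ} (ha : ∀ h ∈ H, a⁻¹ * h * a ∈ H) (hb : ∀ h ∈ H, b⁻¹ * h * b ∈ H) :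
    isometry hH (a * b) = isometry hH a * isometry hH b := by
  rw [isometry, isometry, isometry, smul_mul_assoc, mul_smul_comm, smul_smul,
    char_mul_char hH ha hb, heckeR_mul hH ha hb, Nat.cast_mul, Real.sqrt_mul (Nat.cast_nonneg _),
    mul_inv, Complex.ofReal_mul]

theorem char_mul_mul_char_inv_val {γ : Γ} (hγ : ∀ h ∈ H, γ⁻¹ * h * γ ∈ H) (f : HeckeAlgebra hH)
    (k : Γ) : (char hH γ * f * char hH γ⁻¹).1 k = f.1 (γ⁻¹ * k * γ) := by
  rw [mul_char_val hH _ (inv_conj_mem hγ), char_mul_val hH _ hγ, inv_inv, mul_assoc]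

end Isometry

end HeckeAlgebra

/-! ### The action of the semigroup on the group algebra -/

section Action

open SemidirectProduct HeckeAlgebra

variable {N G : Type u} [Group N] [Group G] {φ : G →* MulAut N}
  {Γ₀ : Subgroup N} [hn : Γ₀.Normal] {S : Subsemigroup G}
  (hΓ : IsHeckePair (Γ₀.map (inl : N →* N ⋊[φ] G)))
  (hinv : ∀ s ∈ S, Γ₀.map (φ s⁻¹).toMonoidHom ≤ Γ₀)

/-- The embedding of `ℂ(N/Γ₀)` in `𝓗(N ⋊ G, Γ₀)`. -/
def groupAlgebraToHecke : MonoidAlgebra ℂ (N ⧸ Γ₀) →⋆ₐ[ℂ] HeckeAlgebra hΓ :=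
  ofGroupAlgebra hΓ inl rfl

theorem groupAlgebraToHecke_injective : Function.Injective (groupAlgebraToHecke hΓ) :=
  ofGroupAlgebra_injective hΓ inl rfl inl_injective

theorem groupAlgebraToHecke_of (x : N) : groupAlgebraToHecke hΓ
    (MonoidAlgebra.of ℂ (N ⧸ Γ₀) (x : N ⧸ Γ₀)) = char hΓ (inl x) :=
  ofGroupAlgebra_of hΓ inl rfl x

include hinv

/-- `a ↦ v_s a v_s*` on the group algebra. -/
def conjugate (s : S) (a : MonoidAlgebra ℂ (N ⧸ Γ₀)) : MonoidAlgebra ℂ (N ⧸ Γ₀) :=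
  restrict hΓ inl rfl inl_injective (isometry hΓ (inr (s : G)) * groupAlgebraToHecke hΓ a *
    star (isometry hΓ (inr (s : G))))

/-- Conjugation by v_s turns f into R(s)⁻¹ f(s⁻¹·s), which still vanishes off `N` since `N` is the
kernel of the projection to `G`. -/
theorem groupAlgebraToHecke_conjugate (s : S) (a : MonoidAlgebra ℂ (N ⧸ Γ₀)) :
    groupAlgebraToHecke hΓ (conjugate hΓ s a) =
      isometry hΓ (inr (s : G)) * groupAlgebraToHecke hΓ a *
        star (isometry hΓ (inr (s : G))) := by
  refine ofGroupAlgebra_restrict hΓ inl rfl inl_injective _ fun k hk => ?_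
  rw [isometry_mul_mul_star_isometry, smul_val,
    char_mul_mul_char_inv_val hΓ (inr_inv_conj_mem hinv s), groupAlgebraToHecke,
    ofGroupAlgebra_val_of_notMem, mul_zero]
  rw [range_inl_eq_ker_rightHom, MonoidHom.mem_ker] at hk ⊢
  intro h
  apply hk
  rw [map_mul, map_mul, map_inv] at h
  exact conj_eq_one_iff.1 (by rwa [inv_inv] :
    (rightHom (inr (s : G) : N ⋊[φ] G))⁻¹ * rightHom k *
      (rightHom (inr (s : G) : N ⋊[φ] G))⁻¹⁻¹ = 1)

/-- The action of `S` on `ℂ(N/Γ₀)`. -/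
def groupAlgebraAction :
    S →ₙ* (MonoidAlgebra ℂ (N ⧸ Γ₀) →⋆ₙₐ[ℂ] MonoidAlgebra ℂ (N ⧸ Γ₀)) where
  toFun s :=
    { toFun := conjugate hΓ s
      -- Every identity is checked inside the Hecke algebra, where the action is conjugation by v_s.
      -- Multiplicativity uses v_s* v_s = 1.
      map_smul' := fun c a => groupAlgebraToHecke_injective hΓ (by
        simp only [groupAlgebraToHecke_conjugate hΓ hinv, map_smul, mul_smul_comm,
          smul_mul_assoc, MonoidHom.id_apply])
      map_zero' := groupAlgebraToHecke_injective hΓ (by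
        simp only [groupAlgebraToHecke_conjugate hΓ hinv, map_zero, mul_zero, zero_mul])
      map_add' := fun a b => groupAlgebraToHecke_injective hΓ (by
        simp only [groupAlgebraToHecke_conjugate hΓ hinv, map_add, mul_add, add_mul])
      map_mul' := fun a b => groupAlgebraToHecke_injective hΓ (by
        simp only [groupAlgebraToHecke_conjugate hΓ hinv, map_mul, mul_assoc]
        rw [← mul_assoc (star _) (isometry hΓ _),
          star_isometry_mul_self hΓ (inr_inv_conj_mem hinv s), one_mul])
      map_star' := fun a => groupAlgebraToHecke_injective hΓ (by
        simp only [groupAlgebraToHecke_conjugate hΓ hinv, map_star, star_mul, star_star,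
          mul_assoc]) }
  map_mul' s t := by
    refine NonUnitalStarAlgHom.ext fun a => groupAlgebraToHecke_injective hΓ ?_
    change groupAlgebraToHecke hΓ (conjugate hΓ (s * t) a) =
      groupAlgebraToHecke hΓ (conjugate hΓ s (conjugate hΓ t a))
    simp only [groupAlgebraToHecke_conjugate hΓ hinv, MulMemClass.coe_mul, map_mul,
      isometry_mul hΓ (inr_inv_conj_mem hinv s) (inr_inv_conj_mem hinv t), star_mul, mul_assoc]

theorem groupAlgebraToHecke_action (s : S) (a : MonoidAlgebra ℂ (N ⧸ Γ₀)) :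
    groupAlgebraToHecke hΓ (groupAlgebraAction hΓ hinv s a) =
      isometry hΓ (inr (s : G)) * groupAlgebraToHecke hΓ a *
        star (isometry hΓ (inr (s : G))) := groupAlgebraToHecke_conjugate hΓ hinv s a

/-- Follows from [s][x] = [sx] = [sxs⁻¹][s]. It is the hypothesis under which monomials were
manipulated above. -/
theorem groupAlgebraAction_of_eq_mul (s : S) (x : N) :
    groupAlgebraAction hΓ hinv s (MonoidAlgebra.of ℂ (N ⧸ Γ₀) (x : N ⧸ Γ₀)) =
      MonoidAlgebra.of ℂ (N ⧸ Γ₀) ((φ (s : G) x : N) : N ⧸ Γ₀) *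
        groupAlgebraAction hΓ hinv s 1 := by
  apply groupAlgebraToHecke_injective hΓ
  rw [map_mul, groupAlgebraToHecke_action, groupAlgebraToHecke_action, map_one, mul_one,
    groupAlgebraToHecke_of, groupAlgebraToHecke_of, ← mul_assoc]
  congr 1
  rw [isometry, smul_mul_assoc, mul_smul_comm,
    char_mul_char hΓ (inr_inv_conj_mem hinv s) (inl_inv_conj_mem x),
    char_mul_char hΓ (inl_inv_conj_mem _) (inr_inv_conj_mem hinv s), inl_aut,
    map_inv, inv_mul_cancel_right]

theorem groupAlgebraAction_of_coeff (s : S) (x n : N)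
    [DecidableEq (N ⧸ Γ₀)] : (groupAlgebraAction hΓ hinv s
      (MonoidAlgebra.of ℂ (N ⧸ Γ₀) (x : N ⧸ Γ₀))).coeff (n : N ⧸ Γ₀) =
    (heckeR (Γ₀.map (inl : N →* N ⋊[φ] G)) (inr (s : G)) : ℂ)⁻¹ *
      if (x : N ⧸ Γ₀) = (φ (s : G)⁻¹ n : N) then 1 else 0 := by
  rw [← ofGroupAlgebra_val hΓ inl rfl inl_injective]
  change (groupAlgebraToHecke hΓ _).1 _ = _
  rw [groupAlgebraToHecke_action, isometry_mul_mul_star_isometry, smul_val,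
    char_mul_mul_char_inv_val hΓ (inr_inv_conj_mem hinv s), groupAlgebraToHecke_of, char_val,
    ← heckeChar_map (inl : N →* N ⋊[φ] G) rfl inl_injective, inl_aut, inv_inv, map_inv]

theorem groupAlgebraAction_of (s : S) (x : N) :
    groupAlgebraAction hΓ hinv s (MonoidAlgebra.of ℂ (N ⧸ Γ₀) (x : N ⧸ Γ₀)) =
      (heckeR (Γ₀.map (inl : N →* N ⋊[φ] G)) (inr (s : G)) : ℂ)⁻¹ •
        ∑ᶠ y ∈ {y : N ⧸ Γ₀ | ∃ n : N, (n : N ⧸ Γ₀) = y ∧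
          ((φ (s : G)⁻¹ n : N) : N ⧸ Γ₀) = (x : N ⧸ Γ₀)}, MonoidAlgebra.of ℂ (N ⧸ Γ₀) y := by
  classical
  have hR : (heckeR (Γ₀.map (inl : N →* N ⋊[φ] G)) (inr (s : G)) : ℂ)⁻¹ ≠ 0 :=
    inv_ne_zero (Nat.cast_ne_zero.2 (heckeR_ne_zero hΓ _))
  -- Because s⁻¹Γ₀s ⊂ Γ₀, the condition does not depend on the representative of the coset.
  have hmem : ∀ n : N, (n : N ⧸ Γ₀) ∈ {y : N ⧸ Γ₀ | ∃ n : N, (n : N ⧸ Γ₀) = y ∧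
      ((φ (s : G)⁻¹ n : N) : N ⧸ Γ₀) = (x : N ⧸ Γ₀)} ↔
      (x : N ⧸ Γ₀) = (φ (s : G)⁻¹ n : N) := by
    intro n
    constructor
    · rintro ⟨m, hm, h⟩
      rw [← h, QuotientGroup.eq]
      rw [QuotientGroup.eq] at hm
      rw [← map_inv, ← map_mul]
      exact hinv s s.2 ⟨_, hm, rfl⟩
    · intro h
      exact ⟨n, rfl, h.symm⟩
  -- Without finiteness the `finsum` would default to 0. The set lies in the finite support of
  -- α_s(e(x)), whose coefficient there is R(s)⁻¹ ≠ 0.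
  have hfinite : {y : N ⧸ Γ₀ | ∃ n : N, (n : N ⧸ Γ₀) = y ∧
      ((φ (s : G)⁻¹ n : N) : N ⧸ Γ₀) = (x : N ⧸ Γ₀)}.Finite := by
    refine (groupAlgebraAction hΓ hinv s
      (MonoidAlgebra.of ℂ (N ⧸ Γ₀) (x : N ⧸ Γ₀))).coeff.hasFiniteSupport.subset fun y hy => ?_
    obtain ⟨n, rfl⟩ := QuotientGroup.mk_surjective y
    rw [Function.mem_support, groupAlgebraAction_of_coeff, if_pos ((hmem n).1 hy), mul_one]
    exact hR
  rw [finsum_mem_eq_finite_toFinset_sum _ hfinite]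
  refine MonoidAlgebra.ext (Finsupp.ext fun y => ?_)
  obtain ⟨n, rfl⟩ := QuotientGroup.mk_surjective y
  rw [groupAlgebraAction_of_coeff, MonoidAlgebra.coeff_smul, MonoidAlgebra.coeff_sum,
    Finsupp.smul_apply, smul_eq_mul, Finsupp.finsetSum_apply]
  simp only [MonoidAlgebra.of_apply, MonoidAlgebra.coeff_single, Finsupp.single_apply,
    Finset.sum_ite_eq', Set.Finite.mem_toFinset, hmem]

/-! ### The isomorphism of *-algebras -/

/-- The *-homomorphism `ℂ(N/Γ₀) ⋊_α S → 𝓗(N ⋊ G, Γ₀)`. -/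
def crossedProductToHecke : CrossedProduct (groupAlgebraAction hΓ hinv) →⋆ₐ[ℂ] HeckeAlgebra hΓ :=
  CrossedProduct.lift (groupAlgebraToHecke hΓ) (fun s => isometry hΓ (inr (s : G)))
    (fun s t => by
      rw [MulMemClass.coe_mul, map_mul,
        isometry_mul hΓ (inr_inv_conj_mem hinv s) (inr_inv_conj_mem hinv t)])
    (fun s => star_isometry_mul_self hΓ (inr_inv_conj_mem hinv s))
    (fun s a => (groupAlgebraToHecke_action hΓ hinv s a).symm)

theorem crossedProductToHecke_coeff (x : N) : crossedProductToHecke hΓ hinv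
    (CrossedProduct.coeff _ (MonoidAlgebra.of ℂ (N ⧸ Γ₀) (x : N ⧸ Γ₀))) = char hΓ (inl x) :=
  (CrossedProduct.lift_coeff _ _ _ _ _ _).trans (groupAlgebraToHecke_of hΓ x)

theorem crossedProductToHecke_isom (s : S) : crossedProductToHecke hΓ hinv
    (CrossedProduct.isom _ s) = isometry hΓ (inr (s : G)) :=
  CrossedProduct.lift_isom _ _ _ _ _ _

/-- Both t and xs conjugate `H` into itself in the required direction. So [x][s] = [xs] exactly, and
[t⁻¹][xs] is a nonzero multiple of [t⁻¹xs]. -/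
theorem crossedProductToHecke_monomial (t : S) (x : N) (s : S) :
    ∃ c : ℂ, c ≠ 0 ∧ crossedProductToHecke hΓ hinv (CrossedProduct.monomial _ t x s) =
      c • char hΓ (inr (t : G)⁻¹ * inl x * inr (s : G)) := by
  have hxs : ∀ h ∈ Γ₀.map (inl : N →* N ⋊[φ] G), (inl x * inr (s : G) : N ⋊[φ] G)⁻¹ * h *
      (inl x * inr (s : G)) ∈ Γ₀.map (inl : N →* N ⋊[φ] G) := by
    intro h hh
    simpa [mul_assoc] using inr_inv_conj_mem hinv s _ (inl_inv_conj_mem x h hh)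
  obtain ⟨c, hc, h⟩ := exists_char_inv_mul_char hΓ (inr_inv_conj_mem hinv t) hxs
  have hR : ∀ s : S, (((√(heckeR (Γ₀.map (inl : N →* N ⋊[φ] G)) (inr (s : G)) : ℝ))⁻¹ : ℝ) : ℂ)
      ≠ 0 := by
    intro s
    rw [Complex.ofReal_ne_zero]
    exact inv_ne_zero (Real.sqrt_ne_zero'.2
      (Nat.cast_pos.2 (Nat.pos_of_ne_zero (heckeR_ne_zero hΓ _))))
  refine ⟨_, mul_ne_zero (hR t) (mul_ne_zero (hR s) hc), ?_⟩
  rw [CrossedProduct.monomial, map_mul, map_mul, map_star, crossedProductToHecke_isom,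
    crossedProductToHecke_isom, CrossedProduct.unitary_apply, crossedProductToHecke_coeff,
    HeckeAlgebra.star_isometry, isometry, mul_assoc, mul_smul_comm,
    char_mul_char hΓ (inl_inv_conj_mem x) (inr_inv_conj_mem hinv s), mul_smul_comm,
    smul_mul_assoc, h, smul_smul, smul_smul, map_inv, mul_assoc (inr (t : G))⁻¹]
  congr 1
  ring

variable (hS : (S : Set G)⁻¹ * (S : Set G) = Set.univ)

include hS

theorem crossedProductToHecke_surjective : Function.Surjective (crossedProductToHecke hΓ hinv) := by
  rw [← Set.range_eq_univ]
  have h : (⊤ : Submodule ℂ (HeckeAlgebra hΓ)) ≤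
      LinearMap.range (crossedProductToHecke hΓ hinv).toAlgHom.toLinearMap := by
    rw [← span_range_char, Submodule.span_le]
    rintro _ ⟨k, rfl⟩
    obtain ⟨t, x, s, rfl⟩ := exists_eq_inr_mul_inl_mul_inr hS k
    obtain ⟨c, hc, h⟩ := crossedProductToHecke_monomial hΓ hinv t x s
    refine ⟨c⁻¹ • CrossedProduct.monomial _ t x s, ?_⟩
    rw [map_smul]
    change c⁻¹ • crossedProductToHecke hΓ hinv _ = _
    rw [h, smul_smul, inv_mul_cancel₀ hc, one_smul]
  exact Set.eq_univ_of_forall fun f => h trivial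

/-- One monomial per double coset already spans, and the images of these monomials are nonzero
multiples of linearly independent functions. -/
theorem crossedProductToHecke_injective : Function.Injective (crossedProductToHecke hΓ hinv) := by
  classical
  have hα := groupAlgebraAction_of_eq_mul hΓ hinv
  rw [injective_iff_map_eq_zero]
  intro z hz
  choose t x s hk using exists_eq_inr_mul_inl_mul_inr (φ := φ) hS
  let m (d : DoubleCoset.Quotient (Γ₀.map (inl : N →* N ⋊[φ] G) : Set (N ⋊[φ] G))
    (Γ₀.map (inl : N →* N ⋊[φ] G))) : CrossedProduct (groupAlgebraAction hΓ hinv) :=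
    CrossedProduct.monomial _ (t d.out) (x d.out) (s d.out)
  have hm : ∀ d, ∃ c : ℂ, c ≠ 0 ∧ crossedProductToHecke hΓ hinv (m d) = c • char hΓ d.out := by
    intro d
    obtain ⟨c, hc, h⟩ := crossedProductToHecke_monomial hΓ hinv (t d.out) (x d.out) (s d.out)
    rw [← hk] at h
    exact ⟨c, hc, h⟩
  choose c hc hm using hm
  have hspan : CrossedProduct.monomialSpan (groupAlgebraAction hΓ hinv) ≤
      Submodule.span ℂ (Set.range m) := by
    refine Submodule.span_mono ?_
    rintro _ ⟨⟨t', x', s'⟩, rfl⟩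
    refine ⟨DoubleCoset.mk _ _ (inr (t' : G)⁻¹ * inl x' * inr (s' : G)), ?_⟩
    refine CrossedProduct.monomial_eq_of_mem_doubleCoset hα hS _ _ _ _ _ _ ?_
    rw [← hk]
    obtain ⟨a, b, ha, hb, hab⟩ := DoubleCoset.mk_out_eq_mul (Γ₀.map (inl : N →* N ⋊[φ] G))
      (Γ₀.map (inl : N →* N ⋊[φ] G)) (inr (t' : G)⁻¹ * inl x' * inr (s' : G))
    rw [hab, DoubleCoset.mem_doubleCoset]
    exact ⟨a, ha, b, hb, rfl⟩
  obtain ⟨l, rfl⟩ := Finsupp.mem_span_range_iff_exists_finsupp.1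
    (hspan (CrossedProduct.mem_monomialSpan hα hS z))
  have hl : ∀ d, l d = 0 := by
    intro d
    -- Evaluation at the representative of d isolates the coefficient of d.
    have hval : ∀ F : Finset _, (∑ e ∈ F, (l e * c e) • char hΓ e.out).1 d.out =
        ∑ e ∈ F, if d = e then l e * c e else 0 := by
      intro F
      induction F using Finset.induction_on with
      | empty => rfl
      | insert e F he ih =>
        rw [Finset.sum_insert he, Finset.sum_insert he, add_val, ih, smul_val, char_val,
          heckeChar_out, mul_ite, mul_one, mul_zero, DoubleCoset.out_eq']
    have h0 := congrFun (congrArg Subtype.val hz) d.out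
    rw [Finsupp.sum, map_sum] at h0
    simp only [map_smul, hm, smul_smul] at h0
    rw [hval, Finset.sum_ite_eq] at h0
    by_contra hd
    rw [if_pos (Finsupp.mem_support_iff.2 hd)] at h0
    exact mul_ne_zero hd (hc d) h0
  have : l = 0 := Finsupp.ext hl
  rw [this, Finsupp.sum_zero_index]

/-- The isomorphism `𝓗(N ⋊ G, Γ₀) ≅ ℂ(N/Γ₀) ⋊_α S`. -/
def heckeEquivCrossedProduct :
    HeckeAlgebra hΓ ≃⋆ₐ[ℂ] CrossedProduct (groupAlgebraAction hΓ hinv) :=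
  (StarAlgEquiv.ofBijective (crossedProductToHecke hΓ hinv)
    ⟨crossedProductToHecke_injective hΓ hinv hS,
      crossedProductToHecke_surjective hΓ hinv hS⟩).symm

theorem heckeEquivCrossedProduct_char_inl (x : N) :
    heckeEquivCrossedProduct hΓ hinv hS (char hΓ (inl x)) =
      CrossedProduct.coeff _ (MonoidAlgebra.of ℂ (N ⧸ Γ₀) (x : N ⧸ Γ₀)) := by
  rw [heckeEquivCrossedProduct, StarAlgEquiv.symm_apply_eq]
  exact (crossedProductToHecke_coeff hΓ hinv x).symm

theorem heckeEquivCrossedProduct_isometry (s : S) :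
    heckeEquivCrossedProduct hΓ hinv hS (isometry hΓ (inr (s : G))) = CrossedProduct.isom _ s := by
  rw [heckeEquivCrossedProduct, StarAlgEquiv.symm_apply_eq]
  exact (crossedProductToHecke_isom hΓ hinv s).symm

end Action

/-! ### The universal property of the enveloping C*-algebra -/

section EnvelopeFunctoriality

variable {A : Type u} [Ring A] [StarRing A] [Algebra ℂ A]
  {B : Type u} [Ring B] [StarRing B] [Algebra ℂ B]

theorem HasCStarEnvelope.of_surjective (hA : HasCStarEnvelope A) (f : A →⋆ₐ[ℂ] B)
    (hf : Function.Surjective f) : HasCStarEnvelope B := by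
  intro b
  obtain ⟨a, rfl⟩ := hf b
  refine (hA a).mono ?_
  rintro _ ⟨H, _, _, _, π, rfl⟩
  exact ⟨H, _, _, _, π.comp f, rfl⟩

theorem univNorm_starAlgHom_le (hA : HasCStarEnvelope A) (f : A →⋆ₐ[ℂ] B) (a : A) :
    univNorm (f a) ≤ univNorm a :=
  univNorm_le (univNorm_nonneg a) fun _ _ _ _ π => le_univNorm hA a (π.comp f)

end EnvelopeFunctoriality

namespace CStarEnvelope

open UniformSpace

variable {A : Type u} [Ring A] [StarRing A] [Algebra ℂ A] (hA : HasCStarEnvelope A)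
  {B : Type w} [CStarAlgebra B]

theorem ofAlg_apply (a : A) : ofAlg hA a = coe hA a := rfl

theorem norm_ofAlg (a : A) : ‖ofAlg hA a‖ = univNorm a := norm_coe hA a

section NonUnitalLift

variable (f : A →⋆ₙₐ[ℂ] B) (hf : ∀ a, ‖f a‖ ≤ univNorm a)

/-- The continuous extension of a bounded map to the enveloping C*-algebra, as a function. -/
def extend (f : A → B) : CStarEnvelope hA → B :=
  Completion.extension (α := PreCStar hA) f

include hf

theorem uniformContinuous_of_le :
    UniformContinuous (show PreCStar hA → B from f) :=
  (LipschitzWith.of_dist_le_mul (K := 1) fun a b => by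
    rw [dist_eq_norm, dist_eq_norm, NNReal.coe_one, one_mul]
    refine le_trans (le_of_eq ?_) (hf (show A from a - b))
    exact congrArg norm (map_sub f (show A from a) (show A from b)).symm).uniformContinuous

theorem extend_coe (a : A) : extend hA f (coe hA a) = f a :=
  Completion.extension_coe (uniformContinuous_of_le hA f hf) _

omit hf in
theorem continuous_extend : Continuous (extend hA f) := Completion.continuous_extension

/-- The *-homomorphism of the enveloping C*-algebra that extends a *-homomorphism of `A`. -/
def liftNonUnital : CStarEnvelope hA →⋆ₙₐ[ℂ] B where
  toFun := extend hA f
  map_smul' c x := by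
    have hc := continuous_extend hA f
    induction x using ind with
    | hc =>
      exact isClosed_eq (hc.comp (continuous_const_smul c)) (hc.const_smul c)
    | h a => rw [← coe_smul, extend_coe hA f hf, extend_coe hA f hf, map_smul]; rfl
  map_zero' := by
    have h : coe hA 0 = 0 := map_zero (ofAlg hA)
    rw [← h, extend_coe hA f hf, map_zero]
  map_add' x y := by
    have hc := continuous_extend hA f
    induction x using ind with
    | hc =>
      exact isClosed_eq (hc.comp (continuous_id.add continuous_const))
        (hc.add continuous_const)
    | h a =>
      induction y using ind with
      | hc =>
        exact isClosed_eq (hc.comp (continuous_const.add continuous_id))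
          (continuous_const.add hc)
      | h b => rw [← coe_add, extend_coe hA f hf, extend_coe hA f hf, extend_coe hA f hf, map_add]
  map_mul' x y := by
    have hc := continuous_extend hA f
    induction x using ind with
    | hc =>
      exact isClosed_eq (hc.comp (continuous_id.mul continuous_const))
        (hc.mul continuous_const)
    | h a =>
      induction y using ind with
      | hc =>
        exact isClosed_eq (hc.comp (continuous_const.mul continuous_id))
          (continuous_const.mul hc)
      | h b => rw [← coe_mul, extend_coe hA f hf, extend_coe hA f hf, extend_coe hA f hf, map_mul]
  map_star' x := by
    have hc := continuous_extend hA f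
    induction x using ind with
    | hc =>
      exact isClosed_eq (hc.comp (continuous_star' hA)) (continuous_star.comp hc)
    | h a => rw [star_coe, extend_coe hA f hf, extend_coe hA f hf, map_star]

theorem liftNonUnital_ofAlg (a : A) : liftNonUnital hA f hf (ofAlg hA a) = f a :=
  extend_coe hA f hf a

omit hf in
theorem continuous_liftNonUnital (hf : ∀ a, ‖f a‖ ≤ univNorm a) :
    Continuous (liftNonUnital hA f hf) := continuous_extend hA f

end NonUnitalLift

section Lift

variable (f : A →⋆ₐ[ℂ] B) (hf : ∀ a, ‖f a‖ ≤ univNorm a)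

/-- The unital *-homomorphism of the enveloping C*-algebra that extends a unital *-homomorphism
of `A`. -/
def lift : CStarEnvelope hA →⋆ₐ[ℂ] B :=
  let F := liftNonUnital hA (f : A →⋆ₙₐ[ℂ] B) hf
  have h1 : F 1 = 1 := by
    rw [← map_one (ofAlg hA)]
    exact (liftNonUnital_ofAlg hA _ hf 1).trans (map_one f)
  { toFun := F
    map_one' := h1
    map_mul' := map_mul F
    map_zero' := map_zero F
    map_add' := map_add F
    commutes' := fun c => by
      rw [Algebra.algebraMap_eq_smul_one, map_smul, h1, Algebra.algebraMap_eq_smul_one]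
    map_star' := map_star F }

theorem lift_ofAlg (a : A) : lift hA f hf (ofAlg hA a) = f a := liftNonUnital_ofAlg hA _ hf a

theorem continuous_lift : Continuous (lift hA f hf) := continuous_liftNonUnital hA _ hf

/-- Equality of norms is a closed condition and holds on the dense image of `A`. -/
theorem norm_lift (hf' : ∀ a, ‖f a‖ = univNorm a) (x : CStarEnvelope hA) :
    ‖lift hA f hf x‖ = ‖x‖ := by
  induction x using ind with
  | hc =>
    exact isClosed_eq (continuous_norm.comp (continuous_lift hA f hf)) continuous_norm
  | h a => rw [← ofAlg_apply, lift_ofAlg, norm_ofAlg, hf']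

theorem isometry_lift (hf' : ∀ a, ‖f a‖ = univNorm a) : Isometry (lift hA f hf) :=
  AddMonoidHomClass.isometry_of_norm _ (norm_lift hA f hf hf')

end Lift

end CStarEnvelope

/-! ### Endomorphisms of group C*-algebras -/

section GroupCStar

variable {Q : Type u} [Group Q]

/-- The trivial character of the group algebra. -/
def trivialCharacter (Q : Type u) [Group Q] : MonoidAlgebra ℂ Q →ₐ[ℂ] ℂ :=
  MonoidAlgebra.lift ℂ ℂ Q 1

theorem trivialCharacter_star (a : MonoidAlgebra ℂ Q) :
    trivialCharacter Q (star a) = star (trivialCharacter Q a) := by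
  induction a using MonoidAlgebra.induction_linear with
  | zero => simp
  | add f g hf hg => simp [hf, hg]
  | single q c =>
    simp [trivialCharacter, MonoidAlgebra.star_single_complex, MonoidAlgebra.lift_single]

/-- A non-unital *-homomorphism on the group algebra, made unital by adding the trivial
character on the complement of the image of the unit. -/
def unitalize {B : Type w} [Ring B] [StarRing B] [Algebra ℂ B] [StarModule ℂ B]
    (f : MonoidAlgebra ℂ Q →⋆ₙₐ[ℂ] B) : MonoidAlgebra ℂ Q →⋆ₐ[ℂ] B where
  toFun a := f a + trivialCharacter Q a • (1 - f 1)
  map_one' := by rw [map_one (trivialCharacter Q), one_smul, add_sub_cancel]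
  map_zero' := by rw [map_zero, map_zero, zero_smul, add_zero]
  map_add' a b := by rw [map_add, map_add, add_smul]; abel
  map_mul' a b := by
    -- The element f(1) is a unit for the image of `f`, so the two summands live in orthogonal
    -- corners and the cross terms vanish.
    have h1 : f a * (1 - f 1) = 0 := by rw [mul_sub, ← map_mul, mul_one, mul_one, sub_self]
    have h2 : (1 - f 1) * f b = 0 := by rw [sub_mul, ← map_mul, one_mul, one_mul, sub_self]
    have h3 : (1 - f 1) * (1 - f 1) = 1 - f 1 := by
      rw [sub_mul, mul_sub, mul_sub, ← map_mul, mul_one, one_mul, mul_one, mul_one, sub_self,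
        sub_zero]
    rw [mul_add, add_mul, add_mul, smul_mul_smul_comm, mul_smul_comm, smul_mul_assoc, h1, h2, h3,
      map_mul, map_mul, smul_zero, smul_zero, zero_add, add_zero]
  commutes' c := by
    rw [AlgHom.commutes, Algebra.algebraMap_eq_smul_one, map_smul, Algebra.algebraMap_self_apply,
      smul_sub, add_sub_cancel, ← Algebra.algebraMap_eq_smul_one]
  map_star' a := by
    rw [map_star, trivialCharacter_star, star_add, star_smul, star_sub, star_one, ← map_star f 1,
      star_one]

theorem map_one_mul_unitalize {B : Type w} [Ring B] [StarRing B] [Algebra ℂ B] [StarModule ℂ B]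
    (f : MonoidAlgebra ℂ Q →⋆ₙₐ[ℂ] B) (a : MonoidAlgebra ℂ Q) : f 1 * unitalize f a = f a := by
  change f 1 * (f a + trivialCharacter Q a • (1 - f 1)) = f a
  rw [mul_add, mul_smul_comm, mul_sub, ← map_mul, ← map_mul, one_mul, one_mul, mul_one, sub_self,
    smul_zero, add_zero]

/-- The universal norm is a supremum over unital representations only, so π ∘ f cannot be compared
with it directly. Its unitalization can, and cutting that down by the projection g(1) recovers π ∘ f
without increasing the norm. -/
theorem univNorm_nonUnitalStarAlgHom_le {A : Type u} [Ring A] [StarRing A] [Algebra ℂ A]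
    (f : MonoidAlgebra ℂ Q →⋆ₙₐ[ℂ] A) (a : MonoidAlgebra ℂ Q) :
    univNorm (f a) ≤ univNorm a := by
  refine univNorm_le (univNorm_nonneg a) fun H _ _ _ π => ?_
  let g : MonoidAlgebra ℂ Q →⋆ₙₐ[ℂ] (H →L[ℂ] H) := (π : A →⋆ₙₐ[ℂ] (H →L[ℂ] H)).comp f
  have h1 : ‖g 1‖ ≤ 1 := by
    have h := CStarRing.norm_star_mul_self (x := g 1)
    rw [← map_star, ← map_mul, star_one, one_mul] at h
    nlinarith [norm_nonneg (g 1)]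
  change ‖g a‖ ≤ univNorm a
  rw [← map_one_mul_unitalize g a]
  calc ‖g 1 * unitalize g a‖ ≤ ‖g 1‖ * ‖unitalize g a‖ := norm_mul_le _ _
    _ ≤ 1 * ‖unitalize g a‖ := mul_le_mul_of_nonneg_right h1 (norm_nonneg _)
    _ ≤ univNorm a := by
      rw [one_mul]
      exact le_univNorm (hasCStarEnvelope_groupAlgebra Q) a _

namespace GroupCStar

/-- The extension of a *-endomorphism of the group algebra to the group C*-algebra. -/
def mapEnd (f : MonoidAlgebra ℂ Q →⋆ₙₐ[ℂ] MonoidAlgebra ℂ Q) :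
    GroupCStar Q →⋆ₙₐ[ℂ] GroupCStar Q :=
  CStarEnvelope.liftNonUnital (hasCStarEnvelope_groupAlgebra Q)
    ((ofAlg Q : MonoidAlgebra ℂ Q →⋆ₙₐ[ℂ] GroupCStar Q).comp f) fun a =>
      (CStarEnvelope.norm_ofAlg _ (f a)).trans_le (univNorm_nonUnitalStarAlgHom_le f a)

theorem mapEnd_ofAlg (f : MonoidAlgebra ℂ Q →⋆ₙₐ[ℂ] MonoidAlgebra ℂ Q) (a : MonoidAlgebra ℂ Q) :
    mapEnd f (ofAlg Q a) = ofAlg Q (f a) :=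
  CStarEnvelope.liftNonUnital_ofAlg _ _ _ _

theorem continuous_mapEnd (f : MonoidAlgebra ℂ Q →⋆ₙₐ[ℂ] MonoidAlgebra ℂ Q) :
    Continuous (mapEnd f) := CStarEnvelope.continuous_liftNonUnital _ _ _

/-- The extension of an action on the group algebra to the group C*-algebra. -/
def extendAction {S : Type v} [Semigroup S]
    (α : S →ₙ* (MonoidAlgebra ℂ Q →⋆ₙₐ[ℂ] MonoidAlgebra ℂ Q)) :
    S →ₙ* (GroupCStar Q →⋆ₙₐ[ℂ] GroupCStar Q) where
  toFun s := mapEnd (α s)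
  map_mul' s t := by
    refine NonUnitalStarAlgHom.ext fun x => ?_
    change mapEnd (α (s * t)) x = mapEnd (α s) (mapEnd (α t) x)
    induction x using CStarEnvelope.ind with
    | hc =>
      exact isClosed_eq (continuous_mapEnd _)
        ((continuous_mapEnd _).comp (continuous_mapEnd _))
    | h a =>
      change mapEnd (α (s * t)) (ofAlg Q a) = mapEnd (α s) (mapEnd (α t) (ofAlg Q a))
      rw [mapEnd_ofAlg, mapEnd_ofAlg, mapEnd_ofAlg, map_mul]
      rfl

theorem extendAction_ofAlg {S : Type v} [Semigroup S]
    (α : S →ₙ* (MonoidAlgebra ℂ Q →⋆ₙₐ[ℂ] MonoidAlgebra ℂ Q)) (s : S) (a : MonoidAlgebra ℂ Q) :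
    extendAction α s (ofAlg Q a) = ofAlg Q (α s a) := mapEnd_ofAlg _ _

theorem continuous_extendAction {S : Type v} [Semigroup S]
    (α : S →ₙ* (MonoidAlgebra ℂ Q →⋆ₙₐ[ℂ] MonoidAlgebra ℂ Q)) (s : S) :
    Continuous (extendAction α s) := continuous_mapEnd _

end GroupCStar

end GroupCStar

/-! ### Completing the crossed product -/

namespace CrossedProduct

variable {Q : Type u} [Group Q] {S : Type u} [Semigroup S]
  (α : S →ₙ* (MonoidAlgebra ℂ Q →⋆ₙₐ[ℂ] MonoidAlgebra ℂ Q))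

/-- Uniform boundedness passes to sums and products, so generators suffice. Isometries have norm at
most 1, and coefficients are bounded by their universal norm in ℂQ. -/
theorem hasCStarEnvelope_of_groupAlgebra : HasCStarEnvelope (CrossedProduct α) := by
  intro x
  induction x using induction with
  | hs c => exact bddAbove_repNorms_algebraMap c
  | hm x y hx hy => exact bddAbove_repNorms_mul hx hy
  | ha x y hx hy => exact bddAbove_repNorms_add hx hy
  | hg g =>
    cases g with
    | iso s => exact bddAbove_repNorms_isometry (star_isom_mul_self α s)
    | coiso s =>
      rw [← star_isom]
      exact bddAbove_repNorms_star (bddAbove_repNorms_isometry (star_isom_mul_self α s))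
    | elt a =>
      refine (hasCStarEnvelope_groupAlgebra Q a).mono ?_
      rintro _ ⟨H, _, _, _, π, rfl⟩
      exact ⟨H, _, _, _, π.comp (coeff α), rfl⟩

/-- The canonical map `ℂQ ⋊_α S → C*(Q) ⋊_α S` of *-algebraic crossed products. -/
def toGroupCStar : CrossedProduct α →⋆ₐ[ℂ] CrossedProduct (GroupCStar.extendAction α) :=
  lift ((coeff (GroupCStar.extendAction α)).comp (GroupCStar.ofAlg Q))
    (isom (GroupCStar.extendAction α)) (isom_mul) (star_isom_mul_self _) fun s a => by
      rw [StarAlgHom.comp_apply, isom_mul_coeff_mul_star, GroupCStar.extendAction_ofAlg]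
      rfl

theorem toGroupCStar_coeff (a : MonoidAlgebra ℂ Q) :
    toGroupCStar α (coeff α a) = coeff (GroupCStar.extendAction α) (GroupCStar.ofAlg Q a) :=
  lift_coeff _ _ _ _ _ _

theorem toGroupCStar_isom (s : S) :
    toGroupCStar α (isom α s) = isom (GroupCStar.extendAction α) s := lift_isom _ _ _ _ _ _

/-! ### Extending covariant representations from the group algebra to the group C*-algebra -/

section ExtendRep

variable {α} {H : Type u} [NormedAddCommGroup H] [InnerProductSpace ℂ H] [CompleteSpace H]
  (π : CrossedProduct α →⋆ₐ[ℂ] (H →L[ℂ] H))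

/-- The extension of the coefficient part of a representation to the group C*-algebra. -/
def extendCoeff : GroupCStar Q →⋆ₐ[ℂ] (H →L[ℂ] H) :=
  CStarEnvelope.lift (hasCStarEnvelope_groupAlgebra Q) (π.comp (coeff α)) fun a =>
    le_univNorm (hasCStarEnvelope_groupAlgebra Q) a _

theorem extendCoeff_ofAlg (a : MonoidAlgebra ℂ Q) :
    extendCoeff π (GroupCStar.ofAlg Q a) = π (coeff α a) :=
  CStarEnvelope.lift_ofAlg _ _ _ _

/-- Covariance is a closed condition in x and holds on the dense image of ℂQ. -/
theorem extendCoeff_covariant (s : S) (x : GroupCStar Q) :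
    π (isom α s) * extendCoeff π x * star (π (isom α s)) =
      extendCoeff π (GroupCStar.extendAction α s x) := by
  have hc : Continuous (extendCoeff π) := CStarEnvelope.continuous_lift _ _ _
  induction x using CStarEnvelope.ind with
  | hc =>
    exact isClosed_eq ((continuous_const.mul hc).mul continuous_const)
      (hc.comp (GroupCStar.continuous_extendAction α s))
  | h a =>
    change _ * extendCoeff π (GroupCStar.ofAlg Q a) * _ =
      extendCoeff π (GroupCStar.extendAction α s (GroupCStar.ofAlg Q a))
    rw [GroupCStar.extendAction_ofAlg, extendCoeff_ofAlg, extendCoeff_ofAlg, ← map_star,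
      ← map_mul, ← map_mul, isom_mul_coeff_mul_star]

/-- The extension of a representation to the crossed product by the group C*-algebra. -/
def extendRep : CrossedProduct (GroupCStar.extendAction α) →⋆ₐ[ℂ] (H →L[ℂ] H) :=
  lift (extendCoeff π) (fun s => π (isom α s)) (fun s t => by rw [isom_mul, map_mul])
    (fun s => by rw [← map_star, ← map_mul, star_isom_mul_self, map_one])
    (extendCoeff_covariant π)

theorem extendRep_toGroupCStar (y : CrossedProduct α) :
    extendRep π (toGroupCStar α y) = π y := by
  have h : ∀ y, y ∈ StarAlgHom.equalizer ((extendRep π).comp (toGroupCStar α)) π := by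
    refine mem_of_generators (fun a => ?_) fun s => ?_
    · change extendRep π (toGroupCStar α _) = _
      rw [toGroupCStar_coeff]
      exact (lift_coeff _ _ _ _ _ _).trans (extendCoeff_ofAlg π a)
    · change extendRep π (toGroupCStar α _) = _
      rw [toGroupCStar_isom]
      exact lift_isom _ _ _ _ _ _
  exact h y

end ExtendRep

/-- Representations pull back along the map, and every representation of ℂQ ⋊ S extends to C*(Q) ⋊
S, so both suprema agree. Injectivity of the map is not needed. -/
theorem univNorm_toGroupCStar (y : CrossedProduct α) :
    univNorm (toGroupCStar α y) = univNorm y := by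
  refine (univNorm_starAlgHom_le (hasCStarEnvelope_of_groupAlgebra α) _ y).antisymm
    (univNorm_le (univNorm_nonneg _) fun H _ _ _ π => ?_)
  rw [← extendRep_toGroupCStar]
  exact le_univNorm (hasCStarEnvelope_crossedProduct _) _ _

/-! ### The enveloping C*-algebra as the C*-algebraic crossed product -/

section Envelope

variable {α} {X : Type u} [Ring X] [StarRing X] [Algebra ℂ X]
  (hX : HasCStarEnvelope X) (e : X ≃⋆ₐ[ℂ] CrossedProduct α)

/-- The map of a *-algebra isomorphic to `ℂQ ⋊_α S` to the C*-algebra `C*(Q) ⋊_α S`. -/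
def toCStarCrossedProduct : X →⋆ₐ[ℂ] CStarCrossedProduct (GroupCStar.extendAction α) :=
  ((CStarCrossedProduct.ofAlg _).comp (toGroupCStar α)).comp (e : X →⋆ₐ[ℂ] CrossedProduct α)

theorem toCStarCrossedProduct_apply (x : X) : toCStarCrossedProduct e x =
    CStarCrossedProduct.ofAlg _ (toGroupCStar α (e x)) := rfl

include hX in
theorem norm_toCStarCrossedProduct (x : X) : ‖toCStarCrossedProduct e x‖ = univNorm x := by
  rw [toCStarCrossedProduct_apply, CStarEnvelope.norm_ofAlg, univNorm_toGroupCStar]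
  refine (univNorm_starAlgHom_le hX (e : X →⋆ₐ[ℂ] CrossedProduct α) x).antisymm ?_
  have h := univNorm_starAlgHom_le (hasCStarEnvelope_of_groupAlgebra α)
    (e.symm : CrossedProduct α →⋆ₐ[ℂ] X) (e x)
  have hx : (e.symm : CrossedProduct α →⋆ₐ[ℂ] X) (e x) = x := e.symm_apply_apply x
  rwa [hx] at h

/-- The map of the enveloping C*-algebra of `ℂQ ⋊_α S` to `C*(Q) ⋊_α S`. -/
def envelopeHom : CStarEnvelope hX →⋆ₐ[ℂ] CStarCrossedProduct (GroupCStar.extendAction α) :=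
  CStarEnvelope.lift hX (toCStarCrossedProduct e) fun x => (norm_toCStarCrossedProduct hX e x).le

theorem envelopeHom_ofAlg (x : X) : envelopeHom hX e (CStarEnvelope.ofAlg hX x) =
    CStarCrossedProduct.ofAlg _ (toGroupCStar α (e x)) := CStarEnvelope.lift_ofAlg _ _ _ _

theorem isometry_envelopeHom : Isometry (envelopeHom hX e) :=
  CStarEnvelope.isometry_lift _ _ _ (norm_toCStarCrossedProduct hX e)

/-- The range is closed, being the isometric image of a complete space. It contains the isometries
and the image of ℂQ, hence by continuity all of C*(Q), hence the dense algebraic crossed product. -/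
theorem envelopeHom_surjective : Function.Surjective (envelopeHom hX e) := by
  have hcl : IsClosed ((envelopeHom hX e).range :
      Set (CStarCrossedProduct (GroupCStar.extendAction α))) :=
    (isometry_envelopeHom hX e).isClosedEmbedding.isClosed_range
  have hmem : ∀ y : CrossedProduct α, CStarCrossedProduct.ofAlg _ (toGroupCStar α y) ∈
      (envelopeHom hX e).range := fun y =>
    ⟨CStarEnvelope.ofAlg hX (e.symm y), by
      rw [← e.apply_symm_apply y, ← envelopeHom_ofAlg hX, e.apply_symm_apply]; rfl⟩
  have hcoeff : ∀ a : GroupCStar Q, CStarCrossedProduct.ofAlg _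
      (coeff (GroupCStar.extendAction α) a) ∈ (envelopeHom hX e).range := by
    -- A *-homomorphism between C*-algebras is automatically contractive.
    have hc : Continuous ((CStarCrossedProduct.ofAlg _).comp
        (coeff (GroupCStar.extendAction α))) :=
      AddMonoidHomClass.continuous_of_bound _ 1 fun a =>
        (NonUnitalStarAlgHom.norm_apply_le _ a).trans_eq (one_mul _).symm
    intro a
    induction a using CStarEnvelope.ind with
    | hc =>
      exact hcl.preimage hc
    | h a =>
      have h := hmem (coeff α a)
      rwa [toGroupCStar_coeff] at h
  have hall : ∀ y, y ∈ (envelopeHom hX e).range.comap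
      (CStarCrossedProduct.ofAlg (GroupCStar.extendAction α)) := by
    refine mem_of_generators hcoeff fun s => ?_
    have h := hmem (isom α s)
    rwa [toGroupCStar_isom] at h
  intro x
  induction x using CStarEnvelope.ind with
  | hc =>
    exact hcl
  | h y => exact hall y

/-- The isomorphism of the enveloping C*-algebra of `ℂQ ⋊_α S` with `C*(Q) ⋊_α S`. -/
def envelopeEquiv : CStarEnvelope hX ≃⋆ₐ[ℂ] CStarCrossedProduct (GroupCStar.extendAction α) :=
  StarAlgEquiv.ofBijective (envelopeHom hX e)
    ⟨(isometry_envelopeHom hX e).injective, envelopeHom_surjective hX e⟩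

theorem envelopeEquiv_ofAlg (x : X) : envelopeEquiv hX e (CStarEnvelope.ofAlg hX x) =
    CStarCrossedProduct.ofAlg _ (toGroupCStar α (e x)) := envelopeHom_ofAlg hX e x

end Envelope

end CrossedProduct

end

/-! ### The Hecke algebra and Hecke C*-algebra of the semidirect product -/

theorem mainTheorem5 {N G : Type u} [Group N] [Group G] (φ : G →* MulAut N)
    (Γ₀ : Subgroup N) [Γ₀.Normal] (S : Subsemigroup G)
    (hS : (S : Set G)⁻¹ * (S : Set G) = Set.univ)
    (hinv : ∀ s ∈ S, Γ₀.map (φ s⁻¹).toMonoidHom ≤ Γ₀)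
    (hfin : ∀ s ∈ S, (Γ₀.map (φ s⁻¹).toMonoidHom).relIndex Γ₀ ≠ 0) :
    ∃ (hN : IsHeckePair Γ₀)
      (hΓ : IsHeckePair (Γ₀.map (SemidirectProduct.inl : N →* N ⋊[φ] G))),
      -- the Hecke algebra of `(N, Γ₀)` is the group algebra of `N/Γ₀`
      (∃ Ψ : HeckeAlgebra hN ≃⋆ₐ[ℂ] MonoidAlgebra ℂ (N ⧸ Γ₀),
        ∀ x : N, Ψ (HeckeAlgebra.char hN x) = MonoidAlgebra.of ℂ (N ⧸ Γ₀) (x : N ⧸ Γ₀)) ∧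
      -- the action `α` of `S` on the group algebra
      ∃ α : S →ₙ* (MonoidAlgebra ℂ (N ⧸ Γ₀) →⋆ₙₐ[ℂ] MonoidAlgebra ℂ (N ⧸ Γ₀)),
        (∀ (s : S) (x : N), α s (MonoidAlgebra.of ℂ (N ⧸ Γ₀) (x : N ⧸ Γ₀)) =
          (heckeR (Γ₀.map (SemidirectProduct.inl : N →* N ⋊[φ] G))
              (SemidirectProduct.inr (s : G)) : ℂ)⁻¹ •
            ∑ᶠ y ∈ {y : N ⧸ Γ₀ | ∃ n : N, (n : N ⧸ Γ₀) = y ∧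
              ((φ (s : G)⁻¹ n : N) : N ⧸ Γ₀) = (x : N ⧸ Γ₀)},
              MonoidAlgebra.of ℂ (N ⧸ Γ₀) y) ∧
        -- the isomorphism of *-algebras
        (∃ Φ : HeckeAlgebra hΓ ≃⋆ₐ[ℂ] CrossedProduct α,
          (∀ x : N, Φ (HeckeAlgebra.char hΓ (SemidirectProduct.inl x)) =
            CrossedProduct.coeff α (MonoidAlgebra.of ℂ (N ⧸ Γ₀) (x : N ⧸ Γ₀))) ∧
          (∀ s : S, Φ ((((√(heckeR (Γ₀.map (SemidirectProduct.inl : N →* N ⋊[φ] G))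
              (SemidirectProduct.inr (s : G)) : ℝ))⁻¹ : ℝ) : ℂ) •
              HeckeAlgebra.char hΓ (SemidirectProduct.inr (s : G))) =
            CrossedProduct.isom α s)) ∧
        -- the isomorphism of C*-algebras
        ∃ (hC : HasCStarEnvelope (HeckeAlgebra hΓ))
          (β : S →ₙ* (GroupCStar (N ⧸ Γ₀) →⋆ₙₐ[ℂ] GroupCStar (N ⧸ Γ₀))),
          (∀ (s : S) (a : MonoidAlgebra ℂ (N ⧸ Γ₀)),
            β s (GroupCStar.ofAlg (N ⧸ Γ₀) a) = GroupCStar.ofAlg (N ⧸ Γ₀) (α s a)) ∧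
          ∃ Φ : CStarEnvelope hC ≃⋆ₐ[ℂ] CStarCrossedProduct β,
            (∀ x : N, Φ (CStarEnvelope.ofAlg hC
                (HeckeAlgebra.char hΓ (SemidirectProduct.inl x))) =
              CStarCrossedProduct.ofAlg β (CrossedProduct.coeff β (GroupCStar.ofAlg (N ⧸ Γ₀)
                (MonoidAlgebra.of ℂ (N ⧸ Γ₀) (x : N ⧸ Γ₀))))) ∧
            (∀ s : S, Φ (CStarEnvelope.ofAlg hC
                ((((√(heckeR (Γ₀.map (SemidirectProduct.inl : N →* N ⋊[φ] G))
                  (SemidirectProduct.inr (s : G)) : ℝ))⁻¹ : ℝ) : ℂ) •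
                  HeckeAlgebra.char hΓ (SemidirectProduct.inr (s : G)))) =
              CStarCrossedProduct.ofAlg β (CrossedProduct.isom β s)) := by
  have hΓ := isHeckePair_map_inl hS hinv hfin
  let e := heckeEquivCrossedProduct hΓ hinv hS
  -- The bound on representations is transported from the crossed product, where it is visible on
  -- generators.
  have hC : HasCStarEnvelope (HeckeAlgebra hΓ) :=
    (CrossedProduct.hasCStarEnvelope_of_groupAlgebra _).of_surjective
      (e.symm : CrossedProduct (groupAlgebraAction hΓ hinv) →⋆ₐ[ℂ] HeckeAlgebra hΓ)
      e.symm.surjective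
  refine ⟨isHeckePair_of_normal Γ₀, hΓ, HeckeAlgebra.exists_starAlgEquiv_groupAlgebra _,
    groupAlgebraAction hΓ hinv, groupAlgebraAction_of hΓ hinv,
    ⟨e, heckeEquivCrossedProduct_char_inl hΓ hinv hS, heckeEquivCrossedProduct_isometry hΓ hinv hS⟩,
    hC, GroupCStar.extendAction (groupAlgebraAction hΓ hinv),
    GroupCStar.extendAction_ofAlg _, CrossedProduct.envelopeEquiv hC e, fun x => ?_, fun s => ?_⟩
  · rw [CrossedProduct.envelopeEquiv_ofAlg, heckeEquivCrossedProduct_char_inl,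
      CrossedProduct.toGroupCStar_coeff]
  · rw [CrossedProduct.envelopeEquiv_ofAlg, ← CrossedProduct.toGroupCStar_isom]
    exact congrArg (fun y => CStarCrossedProduct.ofAlg _ (CrossedProduct.toGroupCStar _ y))
      (heckeEquivCrossedProduct_isometry hΓ hinv hS s)
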